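/- Let $v_0,\dots,v_{n-1}$ ($n\ge 2$, indices modulo $n$, $v_i\ne v_{i+1}$ for all $i$) be the vertices of a closed polygon $P$ in the Euclidean plane, possibly self-intersecting, with perimeter $\mu$, and let $p$ be any point of the plane. For $i=kn+r$ with $k\in\mathbb Z$ and $0\le r<n$ let $e_i=k\mu+\sum_{s<r}|v_sv_{s+1}|$. For $t\in\mathbb R$ let $P(t)$ be the point of $P$ at arc length $t$ (modulo $\mu$) from $v_0$, let $h(t)=|p\,P(t)|$ and $H(t)=(t,h(t))$; the $i$-th segment of the plot of $h$ is its part over $[e_i,e_{i+1})$. For $x\in\mathbb R$ consider the $w<x$ for which the ray from $H(x)$ through $H(w)$ only touches the plot, i.e. the plot is nowhere strictly below this ray. The jump destination $\mathrm{jump}(x)\in\mathbb Z$ is the index of the segment containing $H(w)$ for the rightmost such $w$; if there is no rightmost such $w$, it is the index of the segment containing $H(x)$. A retargeting position is an $x$ at which the jump destination changes, i.e. $\mathrm{jump}$ is not constant on any punctured neighbourhood of $x$; the jump destination that goes with a retargeting position $x$ is the value of $\mathrm{jump}$ immediately to the left of $x$. Theorem. There are a real RAM program (unit cost for arithmetic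 operations, square roots, comparisons and memory accesses, with real and integer cells) and a constant $C$ such that, for all $n$, $v_0,\dots,v_{n-1}$ and $p$ as above, the program with input $n$, $v_0,\dots,v_{n-1}$, $p$ halts after at most $Cn$ steps and outputs a list $(g_1,j_1),\dots,(g_m,j_m)$ of pairs in $\mathbb R\times\mathbb Z$ with $g_1<\dots<g_m<g_1+\mu$ (if $m \geq 1$) such that - the retargeting positions are exactly the numbers $g_a+z\mu$ with $1\le a\le m$ and $z\in\mathbb Z$; - the jump destination that goes with $g_a+z\mu$ is $j_a+zn$; - for every $a$, either $\mathrm{jump}(g_a)=j_a$, or $g_a=e_{j_a+1}$ and $\mathrm{jump}(g_a)=j_a+1$. -/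

import Mathlib

open Filter Topology

/-! ## The plot of the distance function

A closed polygon, possibly self-intersecting, is given by its cyclic sequence of vertices
`v : ZMod n → ℝ²`.  For `i : ℤ` the vertex `v_i` is `v (i : ZMod n)`, and the `i`-th side goes
from `v_i` to `v_{i+1}`. -/

namespace FeedLink

/-- The Euclidean plane. -/
abbrev Plane : Type := EuclideanSpace ℝ (Fin 2)

noncomputable section

variable {n : ℕ}

/-- The length of the `i`-th side. -/
def sideLength (v : ZMod n → Plane) (i : ℤ) : ℝ :=
  dist (v (i : ZMod n)) (v ((i + 1 : ℤ) : ZMod n))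

/-- The perimeter `μ(P)`. -/
def perimeter (v : ZMod n → Plane) : ℝ :=
  ∑ r ∈ Finset.range n, sideLength v r

/-- The left end `e_i` of the `i`-th parameter interval: for `i = k n + r` with `0 ≤ r < n` it is
`k μ(P)` plus the length of the boundary from `v_0` to `v_r`. -/
def breakpoint (v : ZMod n → Plane) (i : ℤ) : ℝ :=
  ((i / (n : ℤ) : ℤ) : ℝ) * perimeter v +
    ∑ r ∈ Finset.range (i % (n : ℤ)).toNat, sideLength v r

/-- The index of the segment above `t`: the (largest) `i` with `e_i ≤ t`, so that
`t ∈ [e_i, e_{i+1})`. -/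
def segIdx (v : ZMod n → Plane) (t : ℝ) : ℤ :=
  sSup {i : ℤ | breakpoint v i ≤ t}

/-- The point `P(t)` of the boundary at arc length `t` (modulo the perimeter) from `v_0`. -/
def boundaryPoint (v : ZMod n → Plane) (t : ℝ) : Plane :=
  AffineMap.lineMap (v (segIdx v t : ZMod n)) (v ((segIdx v t + 1 : ℤ) : ZMod n))
    ((t - breakpoint v (segIdx v t)) / sideLength v (segIdx v t))

/-- The distance function `h(t) = |p P(t)|`. -/
def distFun (v : ZMod n → Plane) (p : Plane) (t : ℝ) : ℝ :=
  dist p (boundaryPoint v t)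

/-- `w < x`, and the ray which starts at `H(x) = (x, h(x))` and goes to the left through
`H(w) = (w, h(w))` only touches the plot of `h`: the plot is nowhere below the ray. -/
def Touches (v : ZMod n → Plane) (p : Plane) (x w : ℝ) : Prop :=
  w < x ∧ ∀ s ≤ x,
    distFun v p x + (distFun v p w - distFun v p x) / (w - x) * (s - x) ≤ distFun v p s

open Classical in
/-- The jump destination of `x`: the index of the segment that contains `H(w)`, for the rightmost
`w < x` such that the ray from `H(x)` through `H(w)` only touches the plot; if there is no such
rightmost `w`, the index of the segment that contains `H(x)`. -/
def jump (v : ZMod n → Plane) (p : Plane) (x : ℝ) : ℤ :=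
  if hw : ∃ w, IsGreatest {w | Touches v p x w} w then segIdx v hw.choose else segIdx v x

/-- `x` is a retargeting position: the jump destination changes when one passes over `x`, that is,
it is not constant on any punctured neighbourhood of `x`. -/
def IsRetargetingPosition (v : ZMod n → Plane) (p : Plane) (x : ℝ) : Prop :=
  ¬ ∃ j : ℤ, ∀ᶠ y in 𝓝[≠] x, jump v p y = j

/-- Going leftwards over `x`, the new jump destination is `j`. -/
def IsDestination (v : ZMod n → Plane) (p : Plane) (x : ℝ) (j : ℤ) : Prop :=
  ∀ᶠ y in 𝓝[<] x, jump v p y = j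

/-- `L` lists the retargeting positions of one period from left to right, each with its jump
destination, and every retargeting position is a translate of a listed one. -/
structure IsRetargetingList (v : ZMod n → Plane) (p : Plane) (L : List (ℝ × ℤ)) : Prop where
  /-- The positions are listed strictly from left to right. -/
  sorted : L.Pairwise fun a b => a.1 < b.1
  /-- The positions lie within one period. -/
  period : ∀ a ∈ L, ∀ b ∈ L, b.1 < a.1 + perimeter v
  /-- Up to translation by periods, exactly the retargeting positions are listed. -/
  complete : ∀ x : ℝ, IsRetargetingPosition v p x ↔
    ∃ a ∈ L, ∃ z : ℤ, x = a.1 + z * perimeter v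
  /-- Every listed position, and every translate of it, comes with its jump destination. -/
  destination : ∀ a ∈ L, ∀ z : ℤ, IsDestination v p (a.1 + z * perimeter v) (a.2 + z * n)
  /-- The listed destination is the value of `jump` at the position itself, unless the position is
  the common endpoint of the segments `j` and `j + 1`, where the former obscures everything on the
  left (`jump` being `j` just before this endpoint) and the latter owns the endpoint. -/
  value : ∀ a ∈ L, jump v p a.1 = a.2 ∨
    (a.1 = breakpoint v (a.2 + 1) ∧ jump v p a.1 = a.2 + 1)

end

end FeedLink

/-! ## Real RAM programs with a step count

The memory consists of integer arrays and real arrays, both named by natural numbers and indexed by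
integers (a program mentions only finitely many of them; a single variable is an array of which one
cell is used).  Each arithmetic operation, square root, comparison, memory access and control step
costs one unit.  There is no rounding and no other passage from reals to integers, and there are no
real constants besides integers.  (Division by zero and roots of negative numbers give zero; a
program can test for them at constant cost.) -/

namespace RealRAM

/-- The contents of the memory. -/
structure State where
  int : ℕ → ℤ → ℤ
  real : ℕ → ℤ → ℝ

/-- Integer expressions. -/
inductive IExp where
  | const (c : ℤ)
  | get (a : ℕ) (i : IExp)
  | add (e f : IExp)
  | sub (e f : IExp)

/-- Real expressions. -/
inductive RExp where
  | const (c : ℤ)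
  | get (a : ℕ) (i : IExp)
  | add (e f : RExp)
  | sub (e f : RExp)
  | mul (e f : RExp)
  | div (e f : RExp)
  | sqrt (e : RExp)

/-- Tests. -/
inductive BExp where
  | leI (e f : IExp)
  | leR (e f : RExp)
  | not (b : BExp)
  | and (b c : BExp)

def IExp.eval (s : State) : IExp → ℤ
  | .const c => c
  | .get a i => s.int a (i.eval s)
  | .add e f => e.eval s + f.eval s
  | .sub e f => e.eval s - f.eval s

def IExp.cost : IExp → ℕ
  | .const _ => 1
  | .get _ i => i.cost + 1
  | .add e f => e.cost + f.cost + 1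
  | .sub e f => e.cost + f.cost + 1

noncomputable def RExp.eval (s : State) : RExp → ℝ
  | .const c => c
  | .get a i => s.real a (i.eval s)
  | .add e f => e.eval s + f.eval s
  | .sub e f => e.eval s - f.eval s
  | .mul e f => e.eval s * f.eval s
  | .div e f => e.eval s / f.eval s
  | .sqrt e => Real.sqrt (e.eval s)

def RExp.cost : RExp → ℕ
  | .const _ => 1
  | .get _ i => i.cost + 1
  | .add e f => e.cost + f.cost + 1
  | .sub e f => e.cost + f.cost + 1
  | .mul e f => e.cost + f.cost + 1
  | .div e f => e.cost + f.cost + 1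
  | .sqrt e => e.cost + 1

def BExp.eval (s : State) : BExp → Prop
  | .leI e f => e.eval s ≤ f.eval s
  | .leR e f => e.eval s ≤ f.eval s
  | .not b => ¬ b.eval s
  | .and b c => b.eval s ∧ c.eval s

def BExp.cost : BExp → ℕ
  | .leI e f => e.cost + f.cost + 1
  | .leR e f => e.cost + f.cost + 1
  | .not b => b.cost + 1
  | .and b c => b.cost + c.cost + 1

/-- Programs: `setI a i e` writes the value of `e` into cell `i` of the integer array `a`, and
`setR` does the same for real arrays. -/
inductive Program where
  | skip
  | setI (a : ℕ) (i e : IExp)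
  | setR (a : ℕ) (i : IExp) (e : RExp)
  | seq (c d : Program)
  | ite (b : BExp) (c d : Program)
  | loop (b : BExp) (c : Program)

def State.writeI (s : State) (a : ℕ) (i x : ℤ) : State :=
  { s with int := Function.update s.int a (Function.update (s.int a) i x) }

noncomputable def State.writeR (s : State) (a : ℕ) (i : ℤ) (x : ℝ) : State :=
  { s with real := Function.update s.real a (Function.update (s.real a) i x) }

/-- `Exec c s s' t`: the program `c`, started in the state `s`, halts in the state `s'` after
exactly `t` steps. -/
inductive Exec : Program → State → State → ℕ → Prop where
  | skip (s : State) : Exec .skip s s 1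
  | setI (a : ℕ) (i e : IExp) (s : State) :
      Exec (.setI a i e) s (s.writeI a (i.eval s) (e.eval s)) (i.cost + e.cost + 1)
  | setR (a : ℕ) (i : IExp) (e : RExp) (s : State) :
      Exec (.setR a i e) s (s.writeR a (i.eval s) (e.eval s)) (i.cost + e.cost + 1)
  | seq {c d : Program} {s s' s'' : State} {t u : ℕ} :
      Exec c s s' t → Exec d s' s'' u → Exec (.seq c d) s s'' (t + u)
  | ite_true {b : BExp} {c d : Program} {s s' : State} {t : ℕ} :
      b.eval s → Exec c s s' t → Exec (.ite b c d) s s' (b.cost + t + 1)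
  | ite_false {b : BExp} {c d : Program} {s s' : State} {t : ℕ} :
      ¬ b.eval s → Exec d s s' t → Exec (.ite b c d) s s' (b.cost + t + 1)
  | loop_done {b : BExp} {c : Program} {s : State} :
      ¬ b.eval s → Exec (.loop b c) s s (b.cost + 1)
  | loop_step {b : BExp} {c : Program} {s s' s'' : State} {t u : ℕ} :
      b.eval s → Exec c s s' t → Exec (.loop b c) s' s'' u →
        Exec (.loop b c) s s'' (b.cost + t + u + 1)

/-- The initial memory: the number `n` in cell `0` of integer array `0`, the coordinates of
`v_0, …, v_{n-1}` in the cells `0, …, n-1` of real arrays `0` and `1`, the coordinates of `p` in the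
cells `0` and `1` of real array `2`, and zeros elsewhere. -/
noncomputable def inputState {n : ℕ} (v : ZMod n → FeedLink.Plane) (p : FeedLink.Plane) :
    State where
  int a i := if a = 0 ∧ i = 0 then (n : ℤ) else 0
  real a i :=
    if a = 0 ∧ 0 ≤ i ∧ i < n then v (i : ZMod n) 0
    else if a = 1 ∧ 0 ≤ i ∧ i < n then v (i : ZMod n) 1
    else if a = 2 ∧ i = 0 then p 0
    else if a = 2 ∧ i = 1 then p 1
    else 0

/-- The output read off the final memory: the length of the list is in cell `0` of integer
array `1`, and its entries are in the cells `0, 1, …` of real array `3` and integer array `2`. -/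
def outputList (s : State) : List (ℝ × ℤ) :=
  (List.range (s.int 1 0).toNat).map fun k => (s.real 3 k, s.int 2 k)

end RealRAM

/-! Over each side the plot of `h` is a convex arc `√((t - c)² + d²)` with slopes in `[-1, 1]`. For
a slope `m` let `φ_i(m)` be the maximum of `m t - h t` over the `i`-th segment (`conj`), so that `t
↦ m t - φ_i(m)` is the line of slope `m` that supports this segment from below. A ray from `H(x)`
only touches the plot iff it lies on a line of some slope `m` for which `m s - h s`, `s ≤ x`, is
maximal at `x` and also at some `w < x` (`touches_iff`). Hence the jump destination is the last
earlier segment `k` that maximizes `φ_k(m)`, where `m x - h x = φ_k(m)` (`jump_eq_of_tangent`),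
unless a line supporting the plot touches it at an earlier point of the segment of `x`, which then
hides everything before it (`jump_eq_self`).

The growth rate of `φ_i` lies between `e_i` and `e_{i+1}`, so `φ_l - φ_k` is nondecreasing for `k <
l` (`conj_sub_conj_mono`). The conjugates therefore cross like pseudolines, and their upper envelope
is a list of segments with increasing indices and increasing crossing slopes: a stack (`IsStack`),
ties going to the later segment. While `x` runs through segment `i`, the slope of the tangent
decreases from a value above `1`. When it reaches the lowest slope of the top segment, at `hitPos`,
the top is popped. When the line becomes a common tangent with segment `i`, of slope `tangentSlope`,
segment `i` is pushed, and the rest of the segment has itself as destination. Between such events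
the destination is constant (`isSpan_pop`, `isSpan_push`, `isSpan_self`), so only the events can be
retargeting positions, and they are so iff the destinations on both sides differ (`IsRecord.next`).
All events have closed formulas with square roots. Every segment is pushed once and popped at most
once, whence the linear time.

The infinite plot is handled by periodicity: comparison of `x` with `x - μ` shows that a supporting
line has slope `m ≥ 0`, so supporting one period suffices (`supp_of_period`). It is enough to start
at `0`, run through the segments before `3 μ` and record what happens in `(μ, 2 μ]`. -/

namespace FeedLink

noncomputable section

open Set

/-! ### The curve `t ↦ √((t - c)² + d²)` -/

/-- The distance from a point at distance `d` of a line to the point `t` of the line, the foot of the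
perpendicular being `c`. -/
def curve (c d t : ℝ) : ℝ := √((t - c) ^ 2 + d ^ 2)

section curve

variable {c d m s t : ℝ}

lemma curve_nonneg : 0 ≤ curve c d t := Real.sqrt_nonneg _

lemma curve_sq : curve c d t ^ 2 = (t - c) ^ 2 + d ^ 2 := Real.sq_sqrt (by positivity)

lemma abs_sub_le_curve : |t - c| ≤ curve c d t := by
  apply Real.abs_le_sqrt
  nlinarith [sq_nonneg d]

lemma sub_le_curve : t - c ≤ curve c d t := (le_abs_self _).trans abs_sub_le_curve

lemma neg_curve_le : -curve c d t ≤ t - c := (abs_le.1 abs_sub_le_curve).1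

/-- As a norm, the arc is 1-Lipschitz by the reverse triangle inequality. -/
lemma curve_eq_norm : curve c d t = ‖(⟨t - c, d⟩ : ℂ)‖ := by
  rw [Complex.norm_def, Complex.normSq_mk, curve]
  congr 1
  ring

lemma abs_curve_sub_le : |curve c d t - curve c d s| ≤ |t - s| := by
  rw [curve_eq_norm, curve_eq_norm]
  refine (abs_norm_sub_norm_le _ _).trans (le_of_eq ?_)
  rw [← Real.norm_eq_abs, ← Complex.norm_real]
  congr 1
  apply Complex.ext <;> simp

lemma continuous_curve : Continuous (curve c d) := by
  unfold curve
  fun_prop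

/-- This difference of squares replaces the mean value theorem. Multiplied by the sum of the two
values, which is positive for `s < t`, a chord is compared with the slope `m` through `m * curve`
and `t - c` at its ends. No derivative is needed, so a zero of the arc does no harm. -/
lemma curve_sub_mul_add :
    (curve c d t - curve c d s) * (curve c d t + curve c d s) = (t - s) * ((t - c) + (s - c)) := by
  have h1 := curve_sq (c := c) (d := d) (t := t)
  have h2 := curve_sq (c := c) (d := d) (t := s)
  linear_combination h1 - h2

lemma curve_add_pos (hst : s < t) : 0 < curve c d t + curve c d s := by
  have h1 := sub_le_curve (c := c) (d := d) (t := t)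
  have h2 := neg_curve_le (c := c) (d := d) (t := s)
  linarith

lemma le_curve_sub (hst : s ≤ t) (hs : m * curve c d s ≤ s - c) (ht : m * curve c d t ≤ t - c) :
    m * (t - s) ≤ curve c d t - curve c d s := by
  rcases hst.eq_or_lt with rfl | hst
  · simp
  have hp := curve_add_pos (c := c) (d := d) hst
  rw [← mul_le_mul_iff_left₀ hp, curve_sub_mul_add]
  nlinarith

lemma curve_sub_le (hst : s ≤ t) (hs : s - c ≤ m * curve c d s) (ht : t - c ≤ m * curve c d t) :
    curve c d t - curve c d s ≤ m * (t - s) := by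
  rcases hst.eq_or_lt with rfl | hst
  · simp
  have hp := curve_add_pos (c := c) (d := d) hst
  rw [← mul_le_mul_iff_left₀ hp, curve_sub_mul_add]
  nlinarith

lemma curve_sub_lt (hst : s < t) (hs : s - c < m * curve c d s) (ht : t - c ≤ m * curve c d t) :
    curve c d t - curve c d s < m * (t - s) := by
  have hp := curve_add_pos (c := c) (d := d) hst
  rw [← mul_lt_mul_iff_left₀ hp, curve_sub_mul_add]
  nlinarith

/-- The sign of the derivative of `curve c d t - m t` is monotone in `t`. -/
lemma sub_mul_curve_mono (hm : |m| ≤ 1) (hst : s ≤ t) :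
    s - c - m * curve c d s ≤ t - c - m * curve c d t := by
  have h := abs_curve_sub_le (c := c) (d := d) (t := t) (s := s)
  have h1 : m * (curve c d t - curve c d s) ≤ t - s := by
    calc _ ≤ |m * (curve c d t - curve c d s)| := le_abs_self _
      _ = |m| * |curve c d t - curve c d s| := abs_mul _ _
      _ ≤ 1 * |t - s| := by gcongr
      _ = t - s := by rw [one_mul, abs_of_nonneg (by linarith)]
  linarith

lemma sub_mul_curve_strictMono (hm : |m| < 1) (hst : s < t) :
    s - c - m * curve c d s < t - c - m * curve c d t := by
  have h := abs_curve_sub_le (c := c) (d := d) (t := t) (s := s)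
  have h1 : m * (curve c d t - curve c d s) < t - s := by
    calc _ ≤ |m * (curve c d t - curve c d s)| := le_abs_self _
      _ = |m| * |curve c d t - curve c d s| := abs_mul _ _
      _ ≤ |m| * |t - s| := by gcongr
      _ < 1 * |t - s| := by
        have : 0 < |t - s| := abs_pos.2 (by linarith)
        gcongr
      _ = t - s := by rw [one_mul, abs_of_nonneg (by linarith)]
  linarith

/-- For `|m| ≤ 1` this is monotonicity; for `m < -1` the conclusion always holds, since `-curve ≤ t
- c`. -/
lemma mul_curve_le_of_le (hm : m ≤ 1) (hst : s ≤ t) (hs : m * curve c d s ≤ s - c) :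
    m * curve c d t ≤ t - c := by
  have h0 := curve_nonneg (c := c) (d := d) (t := t)
  have h1 := neg_curve_le (c := c) (d := d) (t := t)
  rcases le_or_gt (-1) m with h | h
  · have := sub_mul_curve_mono (c := c) (d := d) (abs_le.2 ⟨h, hm⟩) hst
    linarith
  · nlinarith

lemma le_mul_curve_of_le (hm : -1 ≤ m) (hst : s ≤ t) (ht : t - c ≤ m * curve c d t) :
    s - c ≤ m * curve c d s := by
  have h0 := curve_nonneg (c := c) (d := d) (t := s)
  have h1 := sub_le_curve (c := c) (d := d) (t := s)
  rcases le_or_gt m 1 with h | h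
  · have := sub_mul_curve_mono (c := c) (d := d) (abs_le.2 ⟨hm, h⟩) hst
    linarith
  · nlinarith

end curve

/-! ### The slope and the conjugate function of a segment

A plot is given by the breakpoints `e i` and the values `a i` there; on `[e i, e (i + 1)]` it is a
curve `√((t - c)² + d²)`, where `c` and `d` are determined by `e i`, `e (i + 1)`, `a i`,
`a (i + 1)`. -/

section data

variable (e a : ℤ → ℝ) (i : ℤ)

/-- The parameter of the foot of the perpendicular onto the `i`-th side. -/
def foot : ℝ :=
  e i + (a i * a i - a (i + 1) * a (i + 1) + (e (i + 1) - e i) * (e (i + 1) - e i)) /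
    (2 * (e (i + 1) - e i))

/-- The distance to the line that carries the `i`-th side. -/
def height : ℝ := √(a i * a i - (e i - foot e a i) * (e i - foot e a i))

/-- The slope of the plot at the left end of the `i`-th segment (`0` if the plot vanishes there). -/
def slopeL : ℝ := (e i - foot e a i) / a i

/-- The slope of the plot at the right end of the `i`-th segment (`0` if the plot vanishes
there). -/
def slopeR : ℝ := (e (i + 1) - foot e a i) / a (i + 1)

/-- The leftmost point of the `i`-th segment at which `m t - h t` is maximal. -/
def argm (m : ℝ) : ℝ :=
  if m ≤ slopeL e a i then e i
  else if m ≤ slopeR e a i then foot e a i + height e a i * m / √(1 - m * m)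
  else e (i + 1)

/-- The maximum of `m t - h t` over the `i`-th segment. -/
def conj (m : ℝ) : ℝ := m * argm e a i m - curve (foot e a i) (height e a i) (argm e a i m)

end data

/-- `h` is a plot with breakpoints `e i` and values `a i` there. -/
structure IsPlot (e a : ℤ → ℝ) (h : ℝ → ℝ) : Prop where
  lt_succ : ∀ i, e i < e (i + 1)
  apply_eq : ∀ i, h (e i) = a i
  eqOn : ∀ i, ∀ t ∈ Icc (e i) (e (i + 1)), h t = curve (foot e a i) (height e a i) t

/-! ### Convexity of the segments and growth of their conjugates -/

namespace IsPlot

variable {e a : ℤ → ℝ} {h : ℝ → ℝ} (H : IsPlot e a h) {i : ℤ} {m s t : ℝ}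

include H

lemma strictMono : StrictMono e := strictMono_int_of_lt_succ H.lt_succ

lemma mono_lt {j k : ℤ} (hjk : j < k) : e (j + 1) ≤ e k := H.strictMono.monotone hjk

lemma left_mem : e i ∈ Icc (e i) (e (i + 1)) := left_mem_Icc.2 (H.lt_succ i).le

lemma right_mem : e (i + 1) ∈ Icc (e i) (e (i + 1)) := right_mem_Icc.2 (H.lt_succ i).le

lemma curve_left : curve (foot e a i) (height e a i) (e i) = a i :=
  (H.eqOn i _ H.left_mem).symm.trans (H.apply_eq i)

lemma curve_right : curve (foot e a i) (height e a i) (e (i + 1)) = a (i + 1) :=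
  (H.eqOn i _ H.right_mem).symm.trans (H.apply_eq (i + 1))

lemma value_nonneg : 0 ≤ a i := H.curve_left ▸ curve_nonneg

lemma abs_left_le : |e i - foot e a i| ≤ a i := by
  rw [← H.curve_left (i := i)]
  exact abs_sub_le_curve

lemma abs_right_le : |e (i + 1) - foot e a i| ≤ a (i + 1) := by
  rw [← H.curve_right (i := i)]
  exact abs_sub_le_curve

lemma abs_slopeL_le : |slopeL e a i| ≤ 1 := by
  rw [slopeL, abs_div, abs_of_nonneg (H.value_nonneg (i := i))]
  exact div_le_one_of_le₀ H.abs_left_le H.value_nonneg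

lemma abs_slopeR_le : |slopeR e a i| ≤ 1 := by
  rw [slopeR, abs_div, abs_of_nonneg (H.value_nonneg (i := i + 1))]
  exact div_le_one_of_le₀ H.abs_right_le H.value_nonneg

/-- Where the plot vanishes, the end of the segment is the foot and both sides are `0`. In this
product form the default value of the quotient is therefore harmless, for any `m`. -/
lemma mul_le_left (hm : m ≤ slopeL e a i) : m * a i ≤ e i - foot e a i := by
  rcases (H.value_nonneg (i := i)).eq_or_lt with h0 | h0
  · have h1 := H.abs_left_le (i := i)
    rw [← h0] at h1 ⊢
    have := abs_nonpos_iff.1 h1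
    simp [this]
  · exact (le_div_iff₀ h0).1 hm

lemma left_le_mul (hm : slopeL e a i ≤ m) : e i - foot e a i ≤ m * a i := by
  rcases (H.value_nonneg (i := i)).eq_or_lt with h0 | h0
  · have h1 := H.abs_left_le (i := i)
    rw [← h0] at h1 ⊢
    have := abs_nonpos_iff.1 h1
    simp [this]
  · exact (div_le_iff₀ h0).1 hm

lemma mul_le_right (hm : m ≤ slopeR e a i) : m * a (i + 1) ≤ e (i + 1) - foot e a i := by
  rcases (H.value_nonneg (i := i + 1)).eq_or_lt with h0 | h0
  · have h1 := H.abs_right_le (i := i)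
    rw [← h0] at h1 ⊢
    have := abs_nonpos_iff.1 h1
    simp [this]
  · exact (le_div_iff₀ h0).1 hm

lemma right_le_mul (hm : slopeR e a i ≤ m) : e (i + 1) - foot e a i ≤ m * a (i + 1) := by
  rcases (H.value_nonneg (i := i + 1)).eq_or_lt with h0 | h0
  · have h1 := H.abs_right_le (i := i)
    rw [← h0] at h1 ⊢
    have := abs_nonpos_iff.1 h1
    simp [this]
  · exact (div_le_iff₀ h0).1 hm

lemma slopeL_le_slopeR : slopeL e a i ≤ slopeR e a i := by
  have h1 := H.mul_le_left (i := i) le_rfl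
  rw [← H.curve_left] at h1
  have h2 := mul_curve_le_of_le (abs_le.1 H.abs_slopeL_le).2 (H.lt_succ i).le h1
  rw [H.curve_right] at h2
  rcases (H.value_nonneg (i := i + 1)).eq_or_lt with h0 | h0
  · have h3 := H.abs_right_le (i := i)
    rw [← h0] at h3
    have h4 := abs_nonpos_iff.1 h3
    rw [slopeR, ← h0, div_zero]
    exact div_nonpos_of_nonpos_of_nonneg (by linarith [H.lt_succ i]) H.value_nonneg
  · exact (le_div_iff₀ h0).2 h2

lemma deriv_left (hm : m ≤ slopeL e a i) (ht : e i ≤ t) :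
    m * curve (foot e a i) (height e a i) t ≤ t - foot e a i := by
  refine mul_curve_le_of_le (hm.trans (abs_le.1 H.abs_slopeL_le).2) ht ?_
  rw [H.curve_left]
  exact H.mul_le_left hm

lemma deriv_right (hm : slopeR e a i ≤ m) (ht : t ≤ e (i + 1)) :
    t - foot e a i ≤ m * curve (foot e a i) (height e a i) t := by
  refine le_mul_curve_of_le ((abs_le.1 H.abs_slopeR_le).1.trans hm) ht ?_
  rw [H.curve_right]
  exact H.right_le_mul hm

lemma height_eq_zero_of_slopeR (h1 : |slopeR e a i| = 1) : height e a i = 0 := by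
  have h2 := curve_sq (c := foot e a i) (d := height e a i) (t := e (i + 1))
  rw [H.curve_right] at h2
  have h0 : a (i + 1) ≠ 0 := by
    intro h0
    simp [slopeR, h0] at h1
  rw [slopeR, abs_div, div_eq_one_iff_eq (by simpa using h0)] at h1
  have h3 : (e (i + 1) - foot e a i) ^ 2 = a (i + 1) ^ 2 := sq_eq_sq_iff_abs_eq_abs _ _ |>.2 h1
  exact pow_eq_zero_iff two_ne_zero |>.1 (by linarith)

/-- In the middle case the slopes are strictly between `-1` and `1`, or the plot is a corner. -/
lemma mid_cases (h1 : slopeL e a i < m) (h2 : m ≤ slopeR e a i) :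
    |m| < 1 ∨ m = 1 ∧ height e a i = 0 := by
  have h3 := (abs_le.1 (H.abs_slopeL_le (i := i))).1
  have h4 := (abs_le.1 (H.abs_slopeR_le (i := i))).2
  rcases (h2.trans h4).eq_or_lt with rfl | h5
  · exact .inr ⟨rfl, H.height_eq_zero_of_slopeR (by rw [le_antisymm h4 h2, abs_one])⟩
  · exact .inl (abs_lt.2 ⟨h3.trans_lt h1, h5⟩)

omit H in
lemma one_sub_pos (hm : |m| < 1) : 0 < 1 - m * m := by
  nlinarith [abs_lt.1 hm]

omit H in
lemma height_nonneg : 0 ≤ height e a i := Real.sqrt_nonneg _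

omit H in
-- This is the point where `t - c = m * curve c d t`, that is, where an arc with `d ≠ 0` has slope
-- `m`.
lemma curve_mid {c d : ℝ} (hd : 0 ≤ d) (hm : |m| < 1) :
    curve c d (c + d * m / √(1 - m * m)) = d / √(1 - m * m) := by
  have h0 := one_sub_pos hm
  have h1 : √(1 - m * m) ^ 2 = 1 - m * m := Real.sq_sqrt h0.le
  have h2 : 0 < √(1 - m * m) := Real.sqrt_pos.2 h0
  rw [curve, ← Real.sqrt_sq (div_nonneg hd h2.le)]
  congr 1
  rw [add_sub_cancel_left, div_pow, div_pow, h1]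
  have h3 := h0.ne'
  rw [eq_div_iff h3, add_mul, div_mul_cancel₀ _ h3]
  ring

/-- Where the derivative of `m t - h t` is positive and where it is nonpositive. -/
lemma argm_spec (m : ℝ) : argm e a i m ∈ Icc (e i) (e (i + 1)) ∧
    (∀ t ∈ Ico (e i) (argm e a i m),
      t - foot e a i ≤ m * curve (foot e a i) (height e a i) t ∧
        (m ≤ 1 → t - foot e a i < m * curve (foot e a i) (height e a i) t)) ∧
    (argm e a i m ≠ e i → argm e a i m - foot e a i ≤
      m * curve (foot e a i) (height e a i) (argm e a i m)) ∧
    (argm e a i m ≠ e (i + 1) → ∀ t ∈ Icc (argm e a i m) (e (i + 1)),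
      m * curve (foot e a i) (height e a i) t ≤ t - foot e a i) := by
  set c := foot e a i with hc
  set d := height e a i with hd
  by_cases h1 : m ≤ slopeL e a i
  · have hw : argm e a i m = e i := if_pos h1
    rw [hw]
    refine ⟨H.left_mem, fun t ht => absurd ht.2 ht.1.not_gt, fun h => absurd rfl h,
      fun _ t ht => H.deriv_left h1 ht.1⟩
  by_cases h2 : m ≤ slopeR e a i
  · have hw : argm e a i m = c + d * m / √(1 - m * m) := by rw [argm, if_neg h1, if_pos h2]
    rw [not_le] at h1
    have hL : curve c d (e i) = a i := H.curve_left
    have hR : curve c d (e (i + 1)) = a (i + 1) := H.curve_right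
    have hl := H.left_le_mul h1.le
    have hr := H.mul_le_right h2
    rcases H.mid_cases h1 h2 with hm | ⟨rfl, h0⟩
    · have hz : argm e a i m - c - m * curve c d (argm e a i m) = 0 := by
        rw [hw, curve_mid height_nonneg hm]
        ring
      have hmem : argm e a i m ∈ Icc (e i) (e (i + 1)) := by
        constructor
        · by_contra! hlt
          have := sub_mul_curve_strictMono (c := c) (d := d) hm hlt
          rw [hL] at this
          linarith
        · by_contra! hlt
          have := sub_mul_curve_strictMono (c := c) (d := d) hm hlt
          rw [hR] at this
          linarith
      refine ⟨hmem, fun t ht => ?_, fun _ => by linarith, fun _ t ht => ?_⟩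
      · have := sub_mul_curve_strictMono (c := c) (d := d) hm ht.2
        exact ⟨by linarith, fun _ => by linarith⟩
      · have := sub_mul_curve_mono (c := c) (d := d) hm.le ht.1
        linarith
    -- The corner: the arc is `|t - c|`, and the division by `√(1 - 1 * 1) = 0` makes `argm` equal
    -- to `c`, which is indeed the leftmost maximum of `t - |t - c|`.
    · replace h0 : d = 0 := h0
      have hw : argm e a i 1 = c := by rw [hw, h0]; simp
      rw [hw]
      have hcv : ∀ t, curve c d t = |t - c| := fun t => by
        rw [curve, h0, zero_pow two_ne_zero, add_zero, Real.sqrt_sq_eq_abs]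
      have hL' : |e i - c| = a i := by rw [← hL, hcv]
      have hR' : |e (i + 1) - c| = a (i + 1) := by rw [← hR, hcv]
      refine ⟨⟨?_, ?_⟩, fun t ht => ?_, fun _ => by rw [hcv]; simp, fun _ t ht => ?_⟩
      · by_contra! hlt
        have h3 : e i - c = a i := by rw [← hL', abs_of_pos (by linarith)]
        have : slopeL e a i = 1 := by
          rw [slopeL, ← hc, h3, div_self]
          linarith
        linarith
      · have := abs_nonneg (e (i + 1) - c)
        linarith
      · rw [hcv, one_mul, abs_of_neg (by linarith [ht.2])]
        exact ⟨by linarith [ht.2], fun _ => by linarith [ht.2]⟩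
      · rw [hcv, one_mul, abs_of_nonneg (by linarith [ht.1])]
  · have hw : argm e a i m = e (i + 1) := by rw [argm, if_neg h1, if_neg h2]
    rw [hw]
    rw [not_le] at h2
    refine ⟨H.right_mem, fun t ht => ⟨H.deriv_right h2.le ht.2.le, fun hm => ?_⟩,
      fun h => H.deriv_right h2.le le_rfl, fun h => absurd rfl h⟩
    refine (H.deriv_right le_rfl ht.2.le).trans_lt ?_
    -- An arc that vanishes before its right end arrives there with slope `1`, which contradicts
    -- `slopeR < m ≤ 1`.
    rcases (curve_nonneg (c := c) (d := d) (t := t)).eq_or_lt with h0 | h0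
    · exfalso
      have h3 := curve_sq (c := c) (d := d) (t := t)
      rw [← h0] at h3
      have h4 : t - c = 0 := by nlinarith
      have h5 : d = 0 := by nlinarith
      have h6 : a (i + 1) = e (i + 1) - c := by
        rw [← H.curve_right, ← hc, ← hd, curve, h5, zero_pow two_ne_zero, add_zero, Real.sqrt_sq]
        linarith [ht.2]
      have h7 : slopeR e a i = 1 := by
        rw [slopeR, ← hc, h6, div_self]
        linarith [ht.2]
      linarith
    · gcongr

/-- Up to `argm m` the function `m t - h t` increases, from there on it does not. -/
lemma strictMonoOn (hm : m ≤ 1) :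
    StrictMonoOn (fun t => m * t - h t) (Icc (e i) (argm e a i m)) := by
  obtain ⟨h1, h2, h3, -⟩ := H.argm_spec (i := i) m
  intro s hs t ht hst
  have hw : argm e a i m ≠ e i := fun hw => by linarith [hs.1, ht.2]
  have h4 := h2 s ⟨hs.1, hst.trans_le ht.2⟩
  have h5 : t - foot e a i ≤ m * curve (foot e a i) (height e a i) t := by
    rcases ht.2.eq_or_lt with h | h
    · rw [h]
      exact h3 hw
    · exact (h2 t ⟨ht.1, h⟩).1
  have := curve_sub_lt hst (h4.2 hm) h5
  simp only
  rw [H.eqOn i s ⟨hs.1, hs.2.trans h1.2⟩, H.eqOn i t ⟨ht.1, ht.2.trans h1.2⟩]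
  linarith

lemma monotoneOn : MonotoneOn (fun t => m * t - h t) (Icc (e i) (argm e a i m)) := by
  obtain ⟨h1, h2, h3, -⟩ := H.argm_spec (i := i) m
  intro s hs t ht hst
  rcases hst.eq_or_lt with rfl | hst
  · rfl
  have hw : argm e a i m ≠ e i := fun hw => by linarith [hs.1, ht.2]
  have h4 := h2 s ⟨hs.1, hst.trans_le ht.2⟩
  have h5 : t - foot e a i ≤ m * curve (foot e a i) (height e a i) t := by
    rcases ht.2.eq_or_lt with h | h
    · rw [h]
      exact h3 hw
    · exact (h2 t ⟨ht.1, h⟩).1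
  have := curve_sub_le hst.le h4.1 h5
  simp only
  rw [H.eqOn i s ⟨hs.1, hs.2.trans h1.2⟩, H.eqOn i t ⟨ht.1, ht.2.trans h1.2⟩]
  linarith

lemma antitoneOn : AntitoneOn (fun t => m * t - h t) (Icc (argm e a i m) (e (i + 1))) := by
  obtain ⟨h1, -, -, h4⟩ := H.argm_spec (i := i) m
  intro s hs t ht hst
  rcases hst.eq_or_lt with rfl | hst
  · rfl
  have hw : argm e a i m ≠ e (i + 1) := fun hw => by linarith [hs.1, ht.2]
  have := le_curve_sub hst.le (h4 hw s hs) (h4 hw t ht)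
  simp only
  rw [H.eqOn i s ⟨h1.1.trans hs.1, hs.2⟩, H.eqOn i t ⟨h1.1.trans ht.1, ht.2⟩]
  linarith

lemma argm_mem : argm e a i m ∈ Icc (e i) (e (i + 1)) := (H.argm_spec m).1

lemma conj_eq : conj e a i m = m * argm e a i m - h (argm e a i m) := by
  rw [conj, H.eqOn i _ H.argm_mem]

lemma le_conj (ht : t ∈ Icc (e i) (e (i + 1))) : m * t - h t ≤ conj e a i m := by
  have hw := H.argm_mem (i := i) (m := m)
  rw [H.conj_eq]
  rcases le_total t (argm e a i m) with h | h
  · exact H.monotoneOn ⟨ht.1, h⟩ ⟨hw.1, le_rfl⟩ h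
  · exact H.antitoneOn ⟨le_rfl, hw.2⟩ ⟨h, ht.2⟩ h

lemma continuousOn : ContinuousOn h (Icc (e i) (e (i + 1))) :=
  continuous_curve.continuousOn.congr (H.eqOn i)

lemma abs_sub_le (hs : s ∈ Icc (e i) (e (i + 1))) (ht : t ∈ Icc (e i) (e (i + 1))) :
    |h t - h s| ≤ |t - s| := by
  rw [H.eqOn i s hs, H.eqOn i t ht]
  exact abs_curve_sub_le

/-- `conj` grows at a rate between `e i` and `e (i + 1)`. -/
lemma conj_sub_le {m' : ℝ} (hm : m ≤ m') :
    conj e a i m' - conj e a i m ≤ (m' - m) * e (i + 1) := by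
  have h1 := H.argm_mem (i := i) (m := m')
  have h2 := H.le_conj (m := m) h1
  rw [H.conj_eq (m := m')]
  nlinarith [h1.2]

lemma le_conj_sub {m' : ℝ} (hm : m ≤ m') :
    (m' - m) * e i ≤ conj e a i m' - conj e a i m := by
  have h1 := H.argm_mem (i := i) (m := m)
  have h2 := H.le_conj (m := m') h1
  rw [H.conj_eq (m := m)]
  nlinarith [h1.1]

lemma continuous_conj : Continuous (conj e a i) := by
  have hle : ∀ x y, x ≤ y → |conj e a i x - conj e a i y| ≤ max |e i| |e (i + 1)| * |x - y| := by
    intro x y hxy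
    rw [abs_sub_comm, abs_sub_comm x, abs_of_nonneg (sub_nonneg.2 hxy), abs_le]
    have h1 := H.conj_sub_le (i := i) hxy
    have h2 := H.le_conj_sub (i := i) hxy
    have h3 : -max |e i| |e (i + 1)| ≤ e i := (neg_le_neg (le_max_left _ _)).trans (neg_abs_le _)
    have h4 : e (i + 1) ≤ max |e i| |e (i + 1)| := (le_abs_self _).trans (le_max_right _ _)
    constructor <;> nlinarith
  refine (LipschitzWith.of_dist_le_mul (K := ⟨max |e i| |e (i + 1)|, by positivity⟩)
    fun x y => ?_).continuous
  rw [Real.dist_eq, Real.dist_eq]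
  rcases le_total x y with hxy | hxy
  · exact hle x y hxy
  · rw [abs_sub_comm, abs_sub_comm x]
    exact hle y x hxy

/-- Conjugates of different segments behave like pseudolines. -/
lemma conj_sub_conj_mono {k l : ℤ} (hkl : k < l) {m' : ℝ} (hm : m ≤ m') :
    conj e a l m - conj e a k m ≤ conj e a l m' - conj e a k m' := by
  have h1 := H.conj_sub_le (i := k) hm
  have h2 := H.le_conj_sub (i := l) hm
  have h3 := H.mono_lt hkl
  nlinarith

/-- The plot is 1-Lipschitz, so `t - h t` is nondecreasing across all segments. This settles the
slope `1`, where the formula in `hitPos` would divide by `0`. -/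
lemma conj_one_le {k l : ℤ} (hkl : k < l) : conj e a k 1 ≤ e l - a l := by
  have h1 : Monotone fun i => e i - h (e i) := by
    refine monotone_int_of_le_succ fun i => ?_
    have := (abs_le.1 (H.abs_sub_le H.left_mem H.right_mem (i := i))).2
    rw [abs_of_nonneg (by linarith [H.lt_succ i])] at this
    linarith
  have h2 := H.argm_mem (i := k) (m := 1)
  have h3 := (abs_le.1 (H.abs_sub_le h2 H.right_mem)).2
  rw [abs_of_nonneg (by linarith [h2.2])] at h3
  have h4 : e (k + 1) - h (e (k + 1)) ≤ e l - h (e l) := h1 hkl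
  rw [H.conj_eq, ← H.apply_eq l]
  linarith

lemma conj_one_mono {k l : ℤ} (hkl : k < l) : conj e a k 1 ≤ conj e a l 1 := by
  have h5 := H.le_conj (m := 1) (H.left_mem (i := l))
  have := H.conj_one_le hkl
  rw [H.apply_eq] at h5
  linarith

/-- Symmetrically, `-t - h t` is nonincreasing, and for `m < -1` the remaining term `(m + 1) t`
makes the inequality strict. Together with `conj_one_mono` this confines all crossings to `[-1, 1]`.
-/
lemma conj_lt_of_lt_neg_one {k l : ℤ} (hkl : k < l) (hm : m < -1) :
    conj e a l m < conj e a k m := by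
  have h1 : Antitone fun i => -1 * e i - h (e i) := by
    refine antitone_int_of_succ_le fun i => ?_
    have := (abs_le.1 (H.abs_sub_le H.left_mem H.right_mem (i := i))).1
    rw [abs_of_nonneg (by linarith [H.lt_succ i])] at this
    linarith
  have h2 := H.argm_mem (i := l) (m := m)
  have h3 := (abs_le.1 (H.abs_sub_le H.left_mem h2)).1
  rw [abs_of_nonneg (by linarith [h2.1])] at h3
  have h4 : -1 * e l - h (e l) ≤ -1 * e k - h (e k) := h1 hkl.le
  have h5 := H.le_conj (m := m) (H.left_mem (i := k))
  have h6 := H.strictMono hkl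
  rw [H.conj_eq]
  nlinarith [h2.1]

lemma conj_of_one_lt (hm : 1 < m) : conj e a i m = m * e (i + 1) - a (i + 1) := by
  have h1 := (abs_le.1 (H.abs_slopeL_le (i := i))).2
  have h2 := (abs_le.1 (H.abs_slopeR_le (i := i))).2
  rw [H.conj_eq, argm, if_neg (by linarith), if_neg (by linarith), H.apply_eq]

end IsPlot
end
end FeedLink

namespace FeedLink

noncomputable section

open Set

/-! ### Common tangents of two segments -/

section data

variable (e a : ℤ → ℝ)

open Classical in
/-- Coefficients `(α, β, γ)` with `conj j m = α m - β √(1 - m²) - γ` near the slope `m` of the common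
tangent of the segments `k` and `i`. -/
def piece (k i j : ℤ) : ℝ × ℝ × ℝ :=
  if conj e a k (slopeL e a j) ≤ conj e a i (slopeL e a j) then (e j, 0, a j)
  else if conj e a k (slopeR e a j) ≤ conj e a i (slopeR e a j) then (foot e a j, height e a j, 0)
  else (e (j + 1), 0, a (j + 1))

/-- The solution of `α m - β √(1 - m²) = γ`. -/
def solveSlope (α β γ : ℝ) : ℝ :=
  (α * γ + β * √(α * α + β * β - γ * γ)) / (α * α + β * β)

/-- The slope of the common tangent of the segments `k` and `i`. -/
def tangentSlope (k i : ℤ) : ℝ :=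
  solveSlope ((piece e a k i i).1 - (piece e a k i k).1)
    ((piece e a k i i).2.1 - (piece e a k i k).2.1)
    ((piece e a k i i).2.2 - (piece e a k i k).2.2)

open Classical in
/-- The leftmost point of the `i`-th segment at which the plot is not above `m t - q`. -/
def hitPos (i : ℤ) (m q : ℝ) : ℝ :=
  if q ≤ m * e i - a i then e i
  else foot e a i + (m * (m * foot e a i - q) -
    √((m * foot e a i - q) * (m * foot e a i - q) -
      (1 - m * m) * (height e a i * height e a i))) / (1 - m * m)

end data

/-- Monotonicity of `x / √(1 - x²)`, cleared of denominators so that `±1` is allowed. -/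
lemma sqrt_one_sub_sq_le {x y : ℝ} (hx : -1 ≤ x) (hxy : x ≤ y) (hy : y ≤ 1) :
    x * √(1 - y * y) ≤ y * √(1 - x * x) := by
  have hx' : 0 ≤ 1 - x * x := by nlinarith
  have hy' : 0 ≤ 1 - y * y := by nlinarith
  have h1 := Real.sqrt_nonneg (1 - x * x)
  have h2 := Real.sqrt_nonneg (1 - y * y)
  have h3 := Real.sq_sqrt hx'
  have h4 := Real.sq_sqrt hy'
  rcases le_total 0 x with h0 | h0
  · apply abs_le_of_sq_le_sq' _ (mul_nonneg (h0.trans hxy) h1) |>.2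
    rw [mul_pow, mul_pow, h3, h4]
    nlinarith
  · rcases le_total 0 y with h5 | h5
    · nlinarith
    · have : -y * √(1 - x * x) ≤ -x * √(1 - y * y) := by
        apply abs_le_of_sq_le_sq' _ (mul_nonneg (by linarith) h2) |>.2
        rw [mul_pow, mul_pow, h3, h4]
        nlinarith
      linarith

/-- With `m = sin θ` the equation reads `α sin θ - β cos θ = γ`. Then `R = α cos θ + β sin θ`
satisfies `R² + γ² = α² + β²`, and `m` is obtained linearly from `γ` and `R`; the hypothesis `R ≥ 0`
selects the root. -/
lemma solveSlope_eq {α β γ m : ℝ} (hm : |m| ≤ 1) (h0 : ¬ (α = 0 ∧ β = 0))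
    (h : α * m - β * √(1 - m * m) = γ) (hR : 0 ≤ α * √(1 - m * m) + β * m) :
    solveSlope α β γ = m := by
  have hm' : 0 ≤ 1 - m * m := by nlinarith [abs_le.1 hm]
  have h1 : √(1 - m * m) ^ 2 = 1 - m * m := Real.sq_sqrt hm'
  set r := √(1 - m * m)
  have hN : α * α + β * β ≠ 0 := by
    intro hN
    apply h0
    constructor <;> nlinarith
  have h2 : √(α * α + β * β - γ * γ) = α * r + β * m := by
    rw [← Real.sqrt_sq hR, ← h]
    congr 1
    linear_combination (-α * α - β * β) * h1
  rw [solveSlope, h2, div_eq_iff hN, ← h]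
  linear_combination β * β * m * h1 - β * β * m * h1

/-! ### Correctness of the formulas for common tangents and hitting points -/

namespace IsPlot

variable {e a : ℤ → ℝ} {h : ℝ → ℝ} (H : IsPlot e a h) {i k j : ℤ} {m s t q : ℝ}

include H

lemma conj_eq_left (hm : m ≤ slopeL e a i) : conj e a i m = m * e i - a i := by
  rw [H.conj_eq, argm, if_pos hm, H.apply_eq]

lemma conj_eq_right (hm : slopeR e a i < m) : conj e a i m = m * e (i + 1) - a (i + 1) := by
  have := H.slopeL_le_slopeR (i := i)
  rw [H.conj_eq, argm, if_neg (by linarith), if_neg (by linarith), H.apply_eq]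

lemma conj_eq_mid (h1 : slopeL e a i < m) (h2 : m ≤ slopeR e a i) :
    conj e a i m = m * foot e a i - height e a i * √(1 - m * m) := by
  rw [conj, argm, if_neg h1.not_ge, if_pos h2]
  rcases H.mid_cases h1 h2 with hm | ⟨rfl, h0⟩
  · rw [curve_mid height_nonneg hm]
    have h3 := one_sub_pos hm
    have h4 : √(1 - m * m) ^ 2 = 1 - m * m := Real.sq_sqrt h3.le
    have h5 := (Real.sqrt_pos.2 h3).ne'
    have h6 : height e a i * √(1 - m * m) = height e a i * (1 - m * m) / √(1 - m * m) := by
      rw [eq_div_iff h5, mul_assoc, ← pow_two, h4]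
    rw [h6]
    field_simp
    ring
  · rw [h0]
    simp [curve]

lemma left_sq : (e i - foot e a i) ^ 2 + height e a i ^ 2 = a i ^ 2 := by
  rw [← H.curve_left, curve_sq]

lemma right_sq : (e (i + 1) - foot e a i) ^ 2 + height e a i ^ 2 = a (i + 1) ^ 2 := by
  rw [← H.curve_right, curve_sq]

omit H in
lemma unit_of_sq {u d b : ℝ} (hd : 0 ≤ d) (hb : 0 < b) (hs : u ^ 2 + d ^ 2 = b ^ 2) :
    √(1 - u / b * (u / b)) = d / b := by
  rw [← Real.sqrt_sq (div_nonneg hd hb.le)]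
  congr 1
  field_simp
  linarith

/-- The mid piece at a slope in the range of the segment touches the segment. -/
lemma mid_bounds (h1 : slopeL e a i < m) (h2 : m ≤ slopeR e a i) :
    e i * √(1 - m * m) ≤ foot e a i * √(1 - m * m) + height e a i * m ∧
      foot e a i * √(1 - m * m) + height e a i * m ≤ e (i + 1) * √(1 - m * m) := by
  have hL := abs_le.1 (H.abs_slopeL_le (i := i))
  have hR := abs_le.1 (H.abs_slopeR_le (i := i))
  have hr := Real.sqrt_nonneg (1 - m * m)
  have hd : 0 ≤ height e a i := height_nonneg
  constructor
  · rcases (H.value_nonneg (i := i)).eq_or_lt with h0 | h0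
    · have h3 := H.left_sq (i := i)
      rw [← h0] at h3
      have h4 : e i - foot e a i = 0 := by nlinarith
      have h5 : height e a i = 0 := by nlinarith
      rw [h5, sub_eq_zero.1 h4]
      simp
    · have h3 := sqrt_one_sub_sq_le hL.1 h1.le (h2.trans hR.2)
      rw [slopeL, unit_of_sq hd h0 H.left_sq, div_mul_eq_mul_div, mul_div_assoc',
        div_le_div_iff_of_pos_right h0] at h3
      nlinarith
  · rcases (H.value_nonneg (i := i + 1)).eq_or_lt with h0 | h0
    · have h3 := H.right_sq (i := i)
      rw [← h0] at h3
      have h4 : e (i + 1) - foot e a i = 0 := by nlinarith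
      have h5 : height e a i = 0 := by nlinarith
      rw [h5, sub_eq_zero.1 h4]
      simp
    · have h3 := sqrt_one_sub_sq_le (hL.1.trans h1.le) h2 hR.2
      rw [slopeR, unit_of_sq hd h0 H.right_sq, div_mul_eq_mul_div, mul_div_assoc',
        div_le_div_iff_of_pos_right h0] at h3
      nlinarith

/-- The common tangent slope of two segments exists. -/
lemma exists_tangent (hki : k < i) (h0 : conj e a i q < conj e a k q) :
    ∃ m, q < m ∧ |m| ≤ 1 ∧ conj e a i m = conj e a k m ∧
      ∀ x, conj e a k x ≤ conj e a i x ↔ m ≤ x := by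
  -- By the pseudoline property `S` is closed upwards. It is also closed, contains `1` and is
  -- bounded below by `-1`, so it is a half-line `[m, ∞)`; equality at `m` follows by taking limits
  -- from the left.
  set S := {x | conj e a k x ≤ conj e a i x} with hS
  have hup : ∀ x ∈ S, ∀ y, x ≤ y → y ∈ S := by
    intro x hx y hxy
    have := H.conj_sub_conj_mono hki hxy
    simp only [hS, mem_ofPred_eq] at hx ⊢
    linarith
  have h1 : (1 : ℝ) ∈ S := H.conj_one_mono hki
  have hq : ∀ x ∈ S, q < x := by
    intro x hx
    by_contra! hxq
    exact absurd h0 (not_lt.2 (hup x hx q hxq))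
  have hn : ∀ x ∈ S, -1 ≤ x := by
    intro x hx
    by_contra! hlt
    exact absurd (H.conj_lt_of_lt_neg_one hki hlt) (not_lt.2 hx)
  have hc : IsClosed S := isClosed_le H.continuous_conj H.continuous_conj
  have hb : BddBelow S := ⟨-1, fun x hx => hn x hx⟩
  have hmem : sInf S ∈ S := hc.csInf_mem ⟨1, h1⟩ hb
  have hiff : ∀ x, x ∈ S ↔ sInf S ≤ x :=
    fun x => ⟨fun hx => csInf_le hb hx, fun hx => hup _ hmem x hx⟩
  refine ⟨sInf S, hq _ hmem, abs_le.2 ⟨hn _ hmem, csInf_le hb h1⟩, le_antisymm ?_ hmem, hiff⟩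
  refine le_of_tendsto_of_tendsto (H.continuous_conj.continuousWithinAt (s := Iio (sInf S)))
    (H.continuous_conj.continuousWithinAt (s := Iio (sInf S))) ?_
  filter_upwards [self_mem_nhdsWithin] with x hx
  exact (not_le.1 fun hx' => absurd ((hiff x).1 hx') (not_le.2 hx)).le

/-- Comparing the two conjugates at an end slope of segment `j` tells on which side of it the still
unknown `m` lies, hence which formula `conj` has at `m`. The cases are cut so that the formula is
also valid just below `m`, which excludes degenerate equations. The last two bounds locate a point
of tangency, scaled by `√(1 - m²)`; for `k < i` they give the sign that `solveSlope_eq` needs. -/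
lemma piece_spec (hiff : ∀ x, conj e a k x ≤ conj e a i x ↔ m ≤ x) (j : ℤ) :
    (∀ᶠ x in 𝓝[<] m, conj e a j x =
      (piece e a k i j).1 * x - (piece e a k i j).2.1 * √(1 - x * x) - (piece e a k i j).2.2) ∧
    conj e a j m =
      (piece e a k i j).1 * m - (piece e a k i j).2.1 * √(1 - m * m) - (piece e a k i j).2.2 ∧
    e j * √(1 - m * m) ≤ (piece e a k i j).1 * √(1 - m * m) + (piece e a k i j).2.1 * m ∧
    (piece e a k i j).1 * √(1 - m * m) + (piece e a k i j).2.1 * m ≤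
      e (j + 1) * √(1 - m * m) := by
  have hlt := H.lt_succ j
  have hr := Real.sqrt_nonneg (1 - m * m)
  by_cases h1 : m ≤ slopeL e a j
  · rw [piece, if_pos ((hiff _).2 h1)]
    refine ⟨?_, ?_, by simp, ?_⟩
    · filter_upwards [self_mem_nhdsWithin] with x hx
      rw [H.conj_eq_left (hx.le.trans h1)]
      ring
    · rw [H.conj_eq_left h1]
      ring
    · simp only [zero_mul, add_zero]
      gcongr
  by_cases h2 : m ≤ slopeR e a j
  · rw [piece, if_neg (fun h => h1 ((hiff _).1 h)), if_pos ((hiff _).2 h2)]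
    rw [not_le] at h1
    refine ⟨?_, ?_, H.mid_bounds h1 h2⟩
    · filter_upwards [Ioo_mem_nhdsLT h1] with x hx
      rw [H.conj_eq_mid hx.1 (hx.2.le.trans h2)]
      ring
    · rw [H.conj_eq_mid h1 h2]
      ring
  · rw [piece, if_neg (fun h => h1 ((hiff _).1 h)), if_neg (fun h => h2 ((hiff _).1 h))]
    rw [not_le] at h2
    refine ⟨?_, ?_, ?_, by simp⟩
    · filter_upwards [Ioo_mem_nhdsLT h2] with x hx
      rw [H.conj_eq_right hx.1]
      ring
    · rw [H.conj_eq_right h2]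
      ring
    · simp only [zero_mul, add_zero]
      gcongr

lemma tangentSlope_spec (hki : k < i) (h0 : conj e a i q < conj e a k q) :
    q < tangentSlope e a k i ∧ tangentSlope e a k i ≤ 1 ∧
      conj e a i (tangentSlope e a k i) = conj e a k (tangentSlope e a k i) ∧
      ∀ x, conj e a k x ≤ conj e a i x ↔ tangentSlope e a k i ≤ x := by
  obtain ⟨m, h1, hm, h2, hiff⟩ := H.exists_tangent hki h0
  suffices hs : tangentSlope e a k i = m by
    rw [hs]
    exact ⟨h1, (abs_le.1 hm).2, h2, hiff⟩
  obtain ⟨hk1, hk2, hk3, hk4⟩ := H.piece_spec hiff k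
  obtain ⟨hi1, hi2, hi3, hi4⟩ := H.piece_spec hiff i
  have hle : e (k + 1) * √(1 - m * m) ≤ e i * √(1 - m * m) :=
    mul_le_mul_of_nonneg_right (H.mono_lt hki) (Real.sqrt_nonneg _)
  refine solveSlope_eq hm ?_ (by linarith) (by linarith)
  -- In the degenerate case both formulas coincide, so the conjugates agree at slopes just below
  -- `m`, against the choice of `m`.
  rintro ⟨hα, hβ⟩
  have hα' := sub_eq_zero.1 hα
  have hβ' := sub_eq_zero.1 hβ
  obtain ⟨x, hx1, hx2, hx3⟩ := (hk1.and (hi1.and self_mem_nhdsWithin)).exists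
  have h3 : conj e a k x ≤ conj e a i x := by
    rw [hx1, hx2, hα', hβ']
    rw [hα', hβ'] at hi2
    linarith
  exact absurd ((hiff x).1 h3) (not_le.2 hx3)

/-- `hitPos` is the first point of the segment at which the plot is not above `m t - q`. -/
lemma hitPos_spec (hm : m ≤ 1) (hq0 : m * e i - a i ≤ q)
    (hq : q ≤ conj e a i m) (hq1 : m = 1 → q ≤ e i - a i) :
    hitPos e a i m q ∈ Icc (e i) (argm e a i m) ∧
      m * hitPos e a i m q - h (hitPos e a i m q) = q ∧
      ∀ t ∈ Ico (e i) (hitPos e a i m q), m * t - h t < q := by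
  have hw := H.argm_mem (i := i) (m := m)
  have hsub : Icc (e i) (argm e a i m) ⊆ Icc (e i) (e (i + 1)) := Icc_subset_Icc_right hw.2
  have hmono := H.strictMonoOn (i := i) hm
  suffices ∃ x ∈ Icc (e i) (argm e a i m), m * x - h x = q ∧ hitPos e a i m q = x by
    obtain ⟨x, hx1, hx2, hx3⟩ := this
    rw [hx3]
    refine ⟨hx1, hx2, fun t ht => ?_⟩
    rw [← hx2]
    exact hmono ⟨ht.1, ht.2.le.trans hx1.2⟩ hx1 ht.2
  by_cases h1 : q ≤ m * e i - a i
  · exact ⟨e i, ⟨le_rfl, hw.1⟩, by rw [H.apply_eq]; linarith, if_pos h1⟩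
  have hcont : ContinuousOn (fun t => m * t - h t) (Icc (e i) (argm e a i m)) :=
    (continuous_const.mul continuous_id).continuousOn.sub (H.continuousOn.mono hsub)
  have hq' : q ∈ Icc (m * e i - h (e i)) (m * argm e a i m - h (argm e a i m)) := by
    rw [← H.conj_eq, H.apply_eq]
    exact ⟨hq0, hq⟩
  obtain ⟨x, hx, hxq⟩ := intermediate_value_Icc hw.1 hcont hq'
  simp only at hxq
  refine ⟨x, hx, hxq, ?_⟩
  have hne : e i ≠ argm e a i m := by
    intro hne
    apply h1
    rw [H.conj_eq, ← hne, H.apply_eq] at hq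
    exact hq
  -- Beyond the first case `hq1` excludes `m = 1`, and `m` exceeds the left slope, which is at least
  -- `-1`. So `1 - m²` is a legitimate divisor.
  have hm1 : |m| < 1 := by
    have hs : ¬ m ≤ slopeL e a i := fun hs => hne (if_pos hs).symm
    have h2 := (abs_le.1 (H.abs_slopeL_le (i := i))).1
    refine abs_lt.2 ⟨by linarith, hm.lt_of_ne ?_⟩
    rintro rfl
    linarith [hq1 rfl]
  have hh := H.eqOn i x (hsub hx)
  have hsq := curve_sq (c := foot e a i) (d := height e a i) (t := x)
  rw [← hh] at hsq
  -- Squaring `m t - q = h t` gives a quadratic equation. Up to `argm` the function `m t - h t`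
  -- increases, and this inequality identifies `x` as the smaller root.
  have hD : x - foot e a i ≤ m * h x := by
    obtain ⟨-, h3, h4, -⟩ := H.argm_spec (i := i) m
    rw [hh]
    rcases hx.2.eq_or_lt with h5 | h5
    · rw [h5]
      exact h4 hne.symm
    · exact (h3 x ⟨hx.1, h5⟩).1
  have hhx : h x = m * x - q := by linarith
  have hpos := one_sub_pos hm1
  rw [hitPos, if_neg h1]
  set c := foot e a i
  set d := height e a i
  have hsqrt : √((m * c - q) * (m * c - q) - (1 - m * m) * (d * d)) =
      m * (m * c - q) - (1 - m * m) * (x - c) := by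
    rw [← Real.sqrt_sq (show 0 ≤ m * (m * c - q) - (1 - m * m) * (x - c) by
      rw [hhx] at hD; nlinarith)]
    congr 1
    rw [hhx] at hsq
    linear_combination (1 - m * m) * hsq
  rw [hsqrt, add_comm, ← eq_sub_iff_add_eq, div_eq_iff hpos.ne']
  ring

end IsPlot
end
end FeedLink

namespace FeedLink

noncomputable section

open Set

/-! ### The plot of a polygon -/

section polygon

variable {n : ℕ} {v : ZMod n → Plane} {p : Plane} {i : ℤ} {t : ℝ}

lemma sideLength_add_period (v : ZMod n → Plane) (i z : ℤ) :
    sideLength v (i + z * n) = sideLength v i := by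
  simp [sideLength]

lemma breakpoint_eq_of_lt (hn : 0 < n) (v : ZMod n → Plane) (k : ℤ) {r : ℕ} (hr : r < n) :
    breakpoint v (k * n + r) = k * perimeter v + ∑ s ∈ Finset.range r, sideLength v s := by
  have hn' : (n : ℤ) ≠ 0 := by exact_mod_cast hn.ne'
  have h1 : ((r : ℤ)) / n = 0 := Int.ediv_eq_zero_of_lt (by positivity) (by exact_mod_cast hr)
  have h2 : ((r : ℤ)) % n = r := Int.emod_eq_of_lt (by positivity) (by exact_mod_cast hr)
  rw [breakpoint, add_comm (k * (n : ℤ)), Int.add_mul_ediv_right _ _ hn',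
    Int.add_mul_emod_self_right, h1, h2, zero_add, Int.toNat_natCast]

lemma exists_eq_period_add (hn : 0 < n) (i : ℤ) : ∃ (k : ℤ) (r : ℕ), r < n ∧ i = k * n + r := by
  have hn' : (n : ℤ) ≠ 0 := by exact_mod_cast hn.ne'
  have h1 := Int.emod_nonneg i hn'
  have h2 := Int.emod_lt_of_pos i (show (0 : ℤ) < n by exact_mod_cast hn)
  refine ⟨i / n, (i % n).toNat, by omega, ?_⟩
  rw [Int.toNat_of_nonneg h1, mul_comm]
  exact (Int.mul_ediv_add_emod i n).symm

lemma breakpoint_add_one (hn : 0 < n) (v : ZMod n → Plane) (i : ℤ) :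
    breakpoint v (i + 1) = breakpoint v i + sideLength v i := by
  obtain ⟨k, r, hr, rfl⟩ := exists_eq_period_add hn i
  have hs : sideLength v (k * n + r) = sideLength v r := by
    rw [add_comm, sideLength_add_period]
  rw [breakpoint_eq_of_lt hn v k hr, hs, add_assoc]
  rcases (Nat.succ_le_of_lt hr).eq_or_lt with h | h
  · have h3 := breakpoint_eq_of_lt hn v (k + 1) hn
    rw [show (k * n + (r + 1 : ℤ)) = (k + 1) * n + ((0 : ℕ) : ℤ) by rw [← h]; push_cast; ring, h3,
      Finset.range_zero, Finset.sum_empty, add_assoc, ← Finset.sum_range_succ]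
    have hp : perimeter v = ∑ s ∈ Finset.range (r + 1), sideLength v s :=
      congrArg (fun m => ∑ s ∈ Finset.range m, sideLength v s) h.symm
    rw [← hp]
    push_cast
    ring
  · have h3 := breakpoint_eq_of_lt hn v k h
    rw [show (k * n + (r + 1 : ℤ)) = k * n + ((r + 1 : ℕ) : ℤ) by push_cast; ring, h3,
      Finset.sum_range_succ, add_assoc]

lemma breakpoint_add_period (hn : 0 < n) (v : ZMod n → Plane) (i z : ℤ) :
    breakpoint v (i + z * n) = breakpoint v i + z * perimeter v := by
  obtain ⟨k, r, hr, rfl⟩ := exists_eq_period_add hn i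
  rw [show k * n + r + z * n = (k + z) * n + (r : ℤ) by ring, breakpoint_eq_of_lt hn v k hr,
    breakpoint_eq_of_lt hn v _ hr]
  push_cast
  ring

lemma breakpoint_zero (v : ZMod n → Plane) : breakpoint v 0 = 0 := by
  simp [breakpoint]

lemma breakpoint_mul (hn : 0 < n) (v : ZMod n → Plane) (z : ℤ) :
    breakpoint v (z * n) = z * perimeter v := by
  have := breakpoint_add_period hn v 0 z
  rwa [zero_add, breakpoint_zero, zero_add] at this

lemma sideLength_pos (hv : ∀ i : ZMod n, v i ≠ v (i + 1)) (i : ℤ) : 0 < sideLength v i := by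
  rw [sideLength, dist_pos]
  push_cast
  exact hv _

lemma breakpoint_strictMono (hn : 0 < n) (hv : ∀ i : ZMod n, v i ≠ v (i + 1)) :
    StrictMono (breakpoint v) :=
  strictMono_int_of_lt_succ fun i => by
    rw [breakpoint_add_one hn]
    linarith [sideLength_pos hv i]

lemma perimeter_pos (hn : 0 < n) (hv : ∀ i : ZMod n, v i ≠ v (i + 1)) : 0 < perimeter v := by
  have h := breakpoint_strictMono hn hv (show (0 : ℤ) < 1 * n by simpa using hn)
  rw [breakpoint_mul hn, breakpoint_zero] at h
  simpa using h

lemma segIdx_eq (hn : 0 < n) (hv : ∀ i : ZMod n, v i ≠ v (i + 1))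
    (ht : t ∈ Ico (breakpoint v i) (breakpoint v (i + 1))) : segIdx v t = i := by
  have hm := breakpoint_strictMono hn hv
  have : {j : ℤ | breakpoint v j ≤ t} = Iic i := by
    ext j
    refine ⟨fun hj => ?_, fun hj => (hm.monotone hj).trans ht.1⟩
    by_contra hlt
    have : breakpoint v (i + 1) ≤ breakpoint v j := hm.monotone (by
      simp only [mem_Iic, not_le] at hlt
      omega)
    exact absurd (this.trans hj) (not_le.2 ht.2)
  rw [segIdx, this, csSup_Iic]

lemma exists_mem_segment (hn : 0 < n) (hv : ∀ i : ZMod n, v i ≠ v (i + 1)) (t : ℝ) :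
    ∃ i, t ∈ Ico (breakpoint v i) (breakpoint v (i + 1)) := by
  have hm := breakpoint_strictMono hn hv
  have hμ := perimeter_pos hn hv
  obtain ⟨a, ha⟩ := exists_int_lt (t / perimeter v)
  obtain ⟨b, hb⟩ := exists_int_gt (t / perimeter v)
  rw [lt_div_iff₀ hμ] at ha
  rw [div_lt_iff₀ hμ] at hb
  obtain ⟨i, hi1, hi2⟩ := Int.exists_greatest_of_bdd (P := fun i => breakpoint v i ≤ t)
    ⟨b * n, fun z hz => by
      by_contra! hlt
      have := hm hlt
      rw [breakpoint_mul hn] at this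
      linarith⟩
    ⟨a * n, by rw [breakpoint_mul hn]; exact ha.le⟩
  refine ⟨i, hi1, ?_⟩
  by_contra! hlt
  have := hi2 _ hlt
  omega

lemma segIdx_spec (hn : 0 < n) (hv : ∀ i : ZMod n, v i ≠ v (i + 1)) (t : ℝ) :
    t ∈ Ico (breakpoint v (segIdx v t)) (breakpoint v (segIdx v t + 1)) := by
  obtain ⟨i, hi⟩ := exists_mem_segment hn hv t
  rwa [segIdx_eq hn hv hi]

lemma segIdx_add_period (hn : 0 < n) (hv : ∀ i : ZMod n, v i ≠ v (i + 1)) (t : ℝ) (z : ℤ) :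
    segIdx v (t + z * perimeter v) = segIdx v t + z * n := by
  have h := segIdx_spec hn hv t
  refine segIdx_eq hn hv ?_
  rw [add_right_comm, breakpoint_add_period hn, breakpoint_add_period hn]
  exact ⟨by linarith [h.1], by linarith [h.2]⟩

lemma distFun_add_period (hn : 0 < n) (hv : ∀ i : ZMod n, v i ≠ v (i + 1)) (t : ℝ) (z : ℤ) :
    distFun v p (t + z * perimeter v) = distFun v p t := by
  simp only [distFun, boundaryPoint, segIdx_add_period hn hv, breakpoint_add_period hn,
    sideLength_add_period]
  simp

/-- At the right end `segIdx` already is `i + 1`, but both parametrizations give the vertex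
`v_{i+1}`. The closed interval makes every segment compact. -/
lemma boundaryPoint_eq (hn : 0 < n) (hv : ∀ i : ZMod n, v i ≠ v (i + 1))
    (ht : t ∈ Icc (breakpoint v i) (breakpoint v (i + 1))) :
    boundaryPoint v t = AffineMap.lineMap (v (i : ZMod n)) (v ((i + 1 : ℤ) : ZMod n))
      ((t - breakpoint v i) / sideLength v i) := by
  rcases ht.2.eq_or_lt with h | h
  · have h1 : segIdx v t = i + 1 := segIdx_eq hn hv ⟨h.ge, by
      rw [h]
      exact breakpoint_strictMono hn hv (by omega)⟩
    have h2 : breakpoint v (i + 1) - breakpoint v i = sideLength v i := by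
      rw [breakpoint_add_one hn]
      ring
    rw [boundaryPoint, h1, h, sub_self, zero_div, AffineMap.lineMap_apply_zero, h2,
      div_self (sideLength_pos hv i).ne', AffineMap.lineMap_apply_one]
  · rw [boundaryPoint, segIdx_eq hn hv ⟨ht.1, h⟩]

lemma distFun_breakpoint (hn : 0 < n) (hv : ∀ i : ZMod n, v i ≠ v (i + 1)) (i : ℤ) :
    distFun v p (breakpoint v i) = dist p (v (i : ZMod n)) := by
  rw [distFun, boundaryPoint_eq hn hv (i := i)
    ⟨le_rfl, (breakpoint_strictMono hn hv (by omega)).le⟩, sub_self, zero_div,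
    AffineMap.lineMap_apply_zero]

/-- The law of cosines: with `L` the length of the side, `I` the inner product of `v_i - p` and
`v_{i+1} - v_i`, and `u = t - e_i`, the squared distance is `|v_i - p|² + 2 u I / L + u²`. So the
foot is at `e_i - I / L`, and Cauchy-Schwarz makes the radicand in `height` nonnegative. -/
lemma isPlot (hn : 0 < n) (hv : ∀ i : ZMod n, v i ≠ v (i + 1)) (p : Plane) :
    IsPlot (breakpoint v) (fun i => distFun v p (breakpoint v i)) (distFun v p) where
  lt_succ i := breakpoint_strictMono hn hv (by omega)
  apply_eq i := rfl
  eqOn i t ht := by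
    have hL := sideLength_pos hv i
    have hsub : breakpoint v (i + 1) - breakpoint v i = sideLength v i := by
      rw [breakpoint_add_one hn]
      ring
    rw [distFun, boundaryPoint_eq hn hv ht, curve, height, foot, hsub, distFun_breakpoint hn hv,
      distFun_breakpoint hn hv]
    set L := sideLength v i with hLdef
    set u := t - breakpoint v i with hu
    set a := v (i : ZMod n) with ha
    set b := v ((i + 1 : ℤ) : ZMod n) with hb
    have hLn : ‖b - a‖ = L := by rw [hLdef, sideLength, dist_comm, dist_eq_norm]
    have hA : dist p a = ‖a - p‖ := by rw [dist_comm, dist_eq_norm]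
    have hB : dist p b * dist p b = ‖a - p‖ ^ 2 + 2 * inner ℝ (a - p) (b - a) + L ^ 2 := by
      rw [dist_comm, dist_eq_norm, show b - p = (a - p) + (b - a) by abel, ← pow_two,
        norm_add_sq_real, hLn]
    set I : ℝ := inner ℝ (a - p) (b - a) with hI
    have hCS : I * I ≤ ‖a - p‖ ^ 2 * L ^ 2 := by
      have := real_inner_mul_inner_self_le (a - p) (b - a)
      rw [real_inner_self_eq_norm_sq, real_inner_self_eq_norm_sq, hLn] at this
      exact this
    have hf : (dist p a * dist p a - dist p b * dist p b + L * L) / (2 * L) = -I / L := by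
      rw [hA, hB]
      field_simp
      ring
    rw [hf, hA]
    have h0 : 0 ≤ ‖a - p‖ * ‖a - p‖ - (breakpoint v i - (breakpoint v i + -I / L)) *
        (breakpoint v i - (breakpoint v i + -I / L)) := by
      have : (breakpoint v i - (breakpoint v i + -I / L)) *
        (breakpoint v i - (breakpoint v i + -I / L)) = I * I / L ^ 2 := by
        field_simp
        ring
      rw [this, sub_nonneg, div_le_iff₀ (by positivity)]
      linarith
    rw [Real.sq_sqrt h0, dist_comm, dist_eq_norm, ← Real.sqrt_sq (norm_nonneg _)]
    congr 1
    rw [AffineMap.lineMap_apply, vsub_eq_sub, vadd_eq_add,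
      show (u / L) • (b - a) + a - p = (a - p) + (u / L) • (b - a) by abel, norm_add_sq_real,
      norm_smul, hLn, real_inner_smul_right, ← hI, mul_pow, Real.norm_eq_abs, sq_abs]
    have : t = u + breakpoint v i := by rw [hu]; ring
    rw [this]
    field_simp
    ring

end polygon

end
end FeedLink

namespace FeedLink

noncomputable section

open Set

/-! ### Jump destinations -/

section jump

variable {n : ℕ} {v : ZMod n → Plane} {p : Plane} {i k : ℤ} {x y w m : ℝ}

lemma touches_iff : Touches v p x w ↔ w < x ∧ ∃ m, m * w - distFun v p w = m * x - distFun v p x ∧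
    ∀ s ≤ x, m * s - distFun v p s ≤ m * x - distFun v p x := by
  refine and_congr_right fun hw => ⟨fun h => ?_, fun ⟨m, h1, h2⟩ s hs => ?_⟩
  · refine ⟨(distFun v p w - distFun v p x) / (w - x), ?_, fun s hs => ?_⟩
    · have : (distFun v p w - distFun v p x) / (w - x) * (w - x) = _ :=
        div_mul_cancel₀ _ (by linarith)
      linarith
    · have := h s hs
      linarith
  · have : (distFun v p w - distFun v p x) / (w - x) = m := by
      rw [div_eq_iff (by linarith)]
      linarith
    rw [this]
    linarith [h2 s hs]

lemma jump_eq_of_isGreatest (h : IsGreatest {w | Touches v p x w} w) :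
    jump v p x = segIdx v w := by
  have hex : ∃ w, IsGreatest {w | Touches v p x w} w := ⟨w, h⟩
  rw [jump, dif_pos hex, hex.choose_spec.unique h]

lemma jump_eq_of_not_exists (h : ¬ ∃ w, IsGreatest {w | Touches v p x w} w) :
    jump v p x = segIdx v x := by
  rw [jump, dif_neg h]

variable (hn : 0 < n) (hv : ∀ i : ZMod n, v i ≠ v (i + 1))

include hn hv

lemma distFun_sub_perimeter (t : ℝ) : distFun v p (t - perimeter v) = distFun v p t := by
  have := distFun_add_period (p := p) hn hv t (-1)
  rwa [Int.cast_neg, Int.cast_one, neg_one_mul, ← sub_eq_add_neg] at this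

/-- The plot has the same height at `x` and at `x - μ`, so a descending line through `H(x)` passes
above `H(x - μ)`. -/
lemma slope_nonneg_of_supp
    (h : m * (x - perimeter v) - distFun v p (x - perimeter v) ≤ m * x - distFun v p x) :
    0 ≤ m := by
  rw [distFun_sub_perimeter hn hv] at h
  have := perimeter_pos hn hv
  by_contra! hm
  nlinarith

/-- A line that supports the plot over one period supports it on the whole left half-line. -/
lemma supp_of_period
    (h : ∀ s ∈ Icc (x - perimeter v) x, m * s - distFun v p s ≤ m * x - distFun v p x) :
    ∀ s ≤ x, m * s - distFun v p s ≤ m * x - distFun v p x := by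
  have hμ := perimeter_pos hn hv
  have hm : 0 ≤ m := slope_nonneg_of_supp hn hv (h _ ⟨le_rfl, by linarith⟩)
  intro s hs
  have h1 := Int.floor_le ((x - s) / perimeter v)
  have h2 := Int.lt_floor_add_one ((x - s) / perimeter v)
  have h0 : 0 ≤ ⌊(x - s) / perimeter v⌋ := Int.floor_nonneg.2 (by
    apply div_nonneg <;> linarith)
  set z := ⌊(x - s) / perimeter v⌋
  rw [le_div_iff₀ hμ] at h1
  rw [div_lt_iff₀ hμ] at h2
  -- Moving `s` to the right by `z` periods into the given one raises `m s - h s` by `m z μ ≥ 0`.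
  have h3 := h (s + z * perimeter v) ⟨by linarith, by linarith⟩
  rw [distFun_add_period hn hv] at h3
  have h4 : 0 ≤ m * (z * perimeter v) :=
    mul_nonneg hm (mul_nonneg (by exact_mod_cast h0) hμ.le)
  linarith

lemma segIdx_nonneg (hx : 0 ≤ x) : 0 ≤ segIdx v x := by
  have h := (segIdx_spec hn hv x).2
  by_contra! hlt
  have := (breakpoint_strictMono hn hv).monotone (show segIdx v x + 1 ≤ 0 by omega)
  rw [breakpoint_zero] at this
  linarith

lemma segIdx_lt (hx : x < breakpoint v i) : segIdx v x < i := by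
  have h := (segIdx_spec hn hv x).1
  by_contra! hlt
  have := (breakpoint_strictMono hn hv).monotone hlt
  linarith

local notation "φ" => conj (breakpoint v) (fun i => distFun v p (breakpoint v i))

/-- The jump destination where the tangent to the plot on the left has its last point of tangency
on the `k`-th segment. -/
lemma jump_eq_of_tangent (hx : x ∈ Ioc (breakpoint v i) (breakpoint v (i + 1)))
    (hki : k < i) (hμx : perimeter v ≤ x) (h1 : φ k m = m * x - distFun v p x)
    (h2 : ∀ l, 0 ≤ l → l < k → φ l m ≤ φ k m) (h3 : ∀ l, k < l → l < i → φ l m < φ k m)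
    (h4 : ∀ s ∈ Ico (breakpoint v i) x, m * s - distFun v p s < m * x - distFun v p x) :
    jump v p x = k := by
  have H := isPlot hn hv p
  have hmono := breakpoint_strictMono hn hv
  set S := {w | w ∈ Icc (breakpoint v k) (breakpoint v (k + 1)) ∧
    m * w - distFun v p w = φ k m} with hS
  have hcont : ContinuousOn (fun t => m * t - distFun v p t)
      (Icc (breakpoint v k) (breakpoint v (k + 1))) :=
    (continuous_const.mul continuous_id).continuousOn.sub H.continuousOn
  have hclosed : IsClosed S := hcont.preimage_isClosed_of_isClosed isClosed_Icc isClosed_singleton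
  have hcomp : IsCompact S := isCompact_Icc.of_isClosed_subset hclosed fun w hw => hw.1
  obtain ⟨w, ⟨hw1, hw2⟩, hwmax⟩ := hcomp.exists_isGreatest
    ⟨argm _ _ k m, H.argm_mem, H.conj_eq.symm⟩
  -- The right end also belongs to the next segment, where the inequality with the line is strict by
  -- `h3` or `h4`. Hence `segIdx` assigns `w` to segment `k`.
  have hlt : w < breakpoint v (k + 1) := by
    refine hw1.2.lt_of_ne fun heq => ?_
    rcases (show k + 1 ≤ i by omega).eq_or_lt with h | h
    · have := h4 w ⟨by rw [heq, h], by rw [heq, h]; exact hx.1⟩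
      linarith
    · have h5 := h3 (k + 1) (by omega) h
      have h6 := H.le_conj (m := m) (H.left_mem (i := k + 1))
      rw [heq] at hw2
      linarith
  have hidx : segIdx v w = k := segIdx_eq hn hv ⟨hw1.1, hlt⟩
  have hke : breakpoint v (k + 1) ≤ breakpoint v i := hmono.monotone (by omega)
  have hwx : w < x := by linarith [hx.1]
  have hsupp : ∀ s ≤ x, m * s - distFun v p s ≤ m * x - distFun v p x := by
    refine supp_of_period hn hv fun s hs => ?_
    rcases hs.2.eq_or_lt with rfl | hsx
    · rfl
    rcases le_or_gt (breakpoint v i) s with hsi | hsi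
    · exact (h4 s ⟨hsi, hsx⟩).le
    have hl0 := segIdx_nonneg hn hv (show 0 ≤ s by linarith [hs.1])
    have hli := segIdx_lt hn hv hsi
    have hspec := segIdx_spec hn hv s
    have hle := H.le_conj (m := m) (Ico_subset_Icc_self hspec)
    refine (hle.trans ?_).trans h1.le
    rcases lt_trichotomy (segIdx v s) k with hl | hl | hl
    · exact h2 _ hl0 hl
    · rw [hl]
    · exact (h3 _ hl hli).le
  rw [← hidx]
  apply jump_eq_of_isGreatest
  refine ⟨touches_iff.2 ⟨hwx, m, hw2.trans h1, hsupp⟩, fun w' hw' => ?_⟩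
  obtain ⟨hw'x, m', hm1, hm2⟩ := touches_iff.1 hw'
  -- Both lines pass through `H(x)`, and neither is above the plot at the contact point of the
  -- other.
  have hmm : m' = m := by
    apply le_antisymm
    · have := hsupp w' hw'x.le
      by_contra! hlt
      nlinarith
    · have := hm2 w hwx.le
      by_contra! hlt
      nlinarith
  rw [hmm] at hm1
  by_contra! hww
  rcases le_or_gt (breakpoint v i) w' with hsi | hsi
  · exact absurd hm1 (h4 w' ⟨hsi, hw'x⟩).ne
  have hli := segIdx_lt hn hv hsi
  have hspec := segIdx_spec hn hv w'
  have hle := H.le_conj (m := m) (Ico_subset_Icc_self hspec)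
  rcases lt_trichotomy (segIdx v w') k with hl | hl | hl
  · have : breakpoint v (segIdx v w' + 1) ≤ breakpoint v k := hmono.monotone (by omega)
    linarith [hspec.2, hw1.1]
  · rw [hl] at hspec
    have := hwmax ⟨Ico_subset_Icc_self hspec, hm1.trans h1.symm⟩
    linarith
  · have := h3 _ hl hli
    linarith

/-- The jump destination to the right of a point where the plot is touched by a line from below. -/
lemma jump_eq_self (hx : breakpoint v i ≤ x) (hy : y ∈ Ioc x (breakpoint v (i + 1)))
    (hμy : perimeter v ≤ y)
    (h : ∀ s ∈ Icc 0 y, m * s - distFun v p s ≤ m * x - distFun v p x) :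
    jump v p y = i ∨ y = breakpoint v (i + 1) ∧ jump v p y = i + 1 := by
  have hmono := breakpoint_strictMono hn hv
  have hμ := perimeter_pos hn hv
  by_cases hex : ∃ w, IsGreatest {w | Touches v p y w} w
  · obtain ⟨w, hw⟩ := hex
    left
    rw [jump_eq_of_isGreatest hw]
    obtain ⟨hwy, m', hm1, hm2⟩ := touches_iff.1 hw.1
    refine segIdx_eq hn hv ⟨?_, by linarith [hy.2]⟩
    refine hx.trans ?_
    by_contra! hwx
    have hm' : 0 ≤ m' := slope_nonneg_of_supp hn hv (hm2 _ (by linarith))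
    -- If `w < 0`, then `w + μ < y`. Support at `w + μ` forces slope `0`, so `w + μ` touches too and
    -- `w` is not the greatest.
    have hw0 : 0 ≤ w := by
      by_contra! hw0
      have hper : distFun v p (w + perimeter v) = distFun v p w := by
        have := distFun_add_period (p := p) hn hv w 1
        simpa using this
      have h1 := hm2 (w + perimeter v) (by linarith)
      rw [hper] at h1
      have h2 : m' = 0 := by
        refine le_antisymm ?_ hm'
        by_contra! hpos
        nlinarith
      have h3 := hw.2 (touches_iff.2 ⟨show w + perimeter v < y by linarith, m', by
        rw [hper, ← hm1, h2]
        ring, hm2⟩)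
      linarith
    have h1 := h w ⟨hw0, hwy.le⟩
    have h2 := h y ⟨hw0.trans hwy.le, le_rfl⟩
    have h3 := hm2 x hy.1.le
    -- `H(x)` is not above the ray from `H(y)`: compare with the line of slope `m` at `y` or at `w`,
    -- according to which slope is larger. So `x` touches as well, against `w < x` being the
    -- greatest.
    have h4 : m' * y - distFun v p y ≤ m' * x - distFun v p x := by
      rcases le_total m' m with hle | hle
      · nlinarith [hy.1]
      · nlinarith
    have h5 := hw.2 (touches_iff.2 ⟨hy.1, m', le_antisymm h3 h4, hm2⟩)
    linarith
  · rw [jump_eq_of_not_exists hex]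
    rcases hy.2.eq_or_lt with h1 | h1
    · exact .inr ⟨h1, segIdx_eq hn hv ⟨h1.ge, by rw [h1]; exact hmono (by omega)⟩⟩
    · exact .inl (segIdx_eq hn hv ⟨by linarith [hy.1], h1⟩)

/-! ### Periodicity of jump destinations and retargeting positions -/

lemma touches_add_period (z : ℤ) (h : Touches v p x w) :
    Touches v p (x + z * perimeter v) (w + z * perimeter v) := by
  rw [touches_iff] at h ⊢
  obtain ⟨h1, m, h2, h3⟩ := h
  refine ⟨by linarith, m, ?_, fun s hs => ?_⟩
  · rw [distFun_add_period hn hv, distFun_add_period hn hv]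
    linarith
  · have h4 := h3 (s + (-z : ℤ) * perimeter v) (by push_cast; linarith)
    rw [distFun_add_period hn hv] at h4 ⊢
    push_cast at h4
    linarith

lemma touches_add_period_iff (z : ℤ) :
    Touches v p (x + z * perimeter v) (w + z * perimeter v) ↔ Touches v p x w := by
  refine ⟨fun h => ?_, touches_add_period hn hv z⟩
  have := touches_add_period hn hv (-z) h
  push_cast at this
  simpa using this

lemma isGreatest_add_period (z : ℤ) (h : IsGreatest {w | Touches v p x w} w) :
    IsGreatest {w | Touches v p (x + z * perimeter v) w} (w + z * perimeter v) := by
  refine ⟨touches_add_period hn hv z h.1, fun w' hw' => ?_⟩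
  have h1 : Touches v p (x + z * perimeter v) (w' - z * perimeter v + z * perimeter v) := by
    rwa [sub_add_cancel]
  have := h.2 ((touches_add_period_iff hn hv z).1 h1)
  linarith

lemma jump_add_period (x : ℝ) (z : ℤ) :
    jump v p (x + z * perimeter v) = jump v p x + z * n := by
  by_cases hex : ∃ w, IsGreatest {w | Touches v p x w} w
  · obtain ⟨w, hw⟩ := hex
    rw [jump_eq_of_isGreatest hw, jump_eq_of_isGreatest (isGreatest_add_period hn hv z hw),
      segIdx_add_period hn hv]
  · rw [jump_eq_of_not_exists hex, jump_eq_of_not_exists, segIdx_add_period hn hv]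
    rintro ⟨w, hw⟩
    have := isGreatest_add_period hn hv (-z) hw
    push_cast at this
    apply hex
    refine ⟨w + -z * perimeter v, ?_⟩
    convert this using 5
    ring

omit hn hv in
lemma tendsto_sub_nhdsWithin (c : ℝ) {s s' : Set ℝ} (hs : ∀ y ∈ s, y - c ∈ s') :
    Tendsto (fun y => y - c) (𝓝[s] (x + c)) (𝓝[s'] x) := by
  refine tendsto_nhdsWithin_iff.2 ⟨?_, ?_⟩
  · have : Tendsto (fun y => y - c) (𝓝 (x + c)) (𝓝 (x + c - c)) :=
      (continuous_id.sub continuous_const).tendsto _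
    rw [add_sub_cancel_right] at this
    exact this.mono_left nhdsWithin_le_nhds
  · filter_upwards [self_mem_nhdsWithin] with y hy using hs y hy

lemma jump_sub_period (y : ℝ) (z : ℤ) :
    jump v p y = jump v p (y - z * perimeter v) + z * n := by
  rw [← jump_add_period hn hv, sub_add_cancel]

lemma IsDestination.add_period {j : ℤ} (h : IsDestination v p x j) (z : ℤ) :
    IsDestination v p (x + z * perimeter v) (j + z * n) := by
  have h1 := (tendsto_sub_nhdsWithin (x := x) (z * perimeter v)
    (s := Iio (x + z * perimeter v)) (s' := Iio x)
    fun y hy => by simp only [mem_Iio] at hy ⊢; linarith).eventually h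
  filter_upwards [h1] with y hy
  rw [jump_sub_period hn hv y z, hy]

lemma IsRetargetingPosition.add_period (h : IsRetargetingPosition v p x) (z : ℤ) :
    IsRetargetingPosition v p (x + z * perimeter v) := by
  rintro ⟨j, hj⟩
  apply h
  refine ⟨j - z * n, ?_⟩
  have h1 := tendsto_sub_nhdsWithin (x := x + z * perimeter v) (-(z * perimeter v)) (s := {x}ᶜ)
    (s' := {x + z * perimeter v}ᶜ) fun y hy => by
      simp only [mem_compl_iff, mem_singleton_iff] at hy ⊢
      intro h
      apply hy
      linarith
  rw [add_neg_cancel_right] at h1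
  filter_upwards [h1.eventually hj] with y hy
  rw [sub_neg_eq_add, jump_add_period hn hv] at hy
  omega

end jump

/-! ### Recording retargeting positions from left to right -/

section record

variable {n : ℕ} {v : ZMod n → Plane} {p : Plane} {X X' : ℝ} {J k : ℤ} {out : List (ℝ × ℤ)}

/-- `jump` has the value `j` at `x`, or `x` is the right end of the `j`-th segment and `jump` has the
value `j + 1` there. -/
def IsValue (v : ZMod n → Plane) (p : Plane) (x : ℝ) (j : ℤ) : Prop :=
  jump v p x = j ∨ (x = breakpoint v (j + 1) ∧ jump v p x = j + 1)

/-- `out` lists what happens between `μ` and `min X (2 μ)`; on the left of `X` the jump destination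
is `J`. -/
structure IsRecord (v : ZMod n → Plane) (p : Plane) (X : ℝ) (J : ℤ) (out : List (ℝ × ℤ)) :
    Prop where
  sorted : out.Pairwise fun a b => a.1 < b.1
  window : ∀ a ∈ out, perimeter v < a.1 ∧ a.1 ≤ 2 * perimeter v ∧ a.1 < X
  retargeting : ∀ a ∈ out, IsRetargetingPosition v p a.1
  destination : ∀ a ∈ out, IsDestination v p a.1 a.2
  value : ∀ a ∈ out, IsValue v p a.1 a.2
  complete : ∀ x, perimeter v < x → x ≤ 2 * perimeter v → x < X → IsRetargetingPosition v p x →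
    ∃ a ∈ out, a.1 = x
  destination_last : perimeter v < X → IsDestination v p X J
  value_last : perimeter v < X → IsValue v p X J

/-- Between `X` and `X'` the jump destination is `k`. -/
structure IsSpan (v : ZMod n → Plane) (p : Plane) (X X' : ℝ) (k : ℤ) : Prop where
  le : X ≤ X'
  jump_eq : ∀ y ∈ Ioo X X', perimeter v < y → jump v p y = k
  value : X < X' → perimeter v < X' → IsValue v p X' k

lemma not_isRetargetingPosition {x x₁ x₂ : ℝ} (h1 : x₁ < x) (h2 : x < x₂) {j : ℤ}
    (h : ∀ y ∈ Ioo x₁ x₂, jump v p y = j) : ¬ IsRetargetingPosition v p x := by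
  intro hr
  refine hr ⟨j, ?_⟩
  filter_upwards [mem_nhdsWithin_of_mem_nhds (Ioo_mem_nhds h1 h2)] with y hy using h y hy

lemma isRetargetingPosition_iff {x : ℝ} {j j' : ℤ} (h1 : ∀ᶠ y in 𝓝[<] x, jump v p y = j)
    (h2 : ∀ᶠ y in 𝓝[>] x, jump v p y = j') : IsRetargetingPosition v p x ↔ j ≠ j' := by
  constructor
  · rintro hr rfl
    refine hr ⟨j, ?_⟩
    rw [← nhdsLT_sup_nhdsGT, eventually_sup]
    exact ⟨h1, h2⟩
  · rintro hne ⟨l, hl⟩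
    rw [← nhdsLT_sup_nhdsGT, eventually_sup] at hl
    obtain ⟨y, hy1, hy2⟩ := (h1.and hl.1).exists
    obtain ⟨z, hz1, hz2⟩ := (h2.and hl.2).exists
    exact hne (by rw [← hy1, hy2, ← hz2, hz1])

open Classical in
/-- Passing to the next position. -/
lemma IsRecord.next (h : IsRecord v p X J out) (hs : IsSpan v p X X' k) (hX : X < X') :
    IsRecord v p X' k (if J ≠ k ∧ perimeter v < X ∧ X ≤ 2 * perimeter v then out ++ [(X, J)]
      else out) := by
  have hdest : perimeter v < X' → IsDestination v p X' k := fun hμ => by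
    filter_upwards [Ioo_mem_nhdsLT (max_lt hX hμ)] with y hy
    exact hs.jump_eq y ⟨(le_max_left _ _).trans_lt hy.1, hy.2⟩ ((le_max_right _ _).trans_lt hy.1)
  have hret : perimeter v < X → (IsRetargetingPosition v p X ↔ J ≠ k) := fun hμ => by
    refine isRetargetingPosition_iff (h.destination_last hμ) ?_
    filter_upwards [Ioo_mem_nhdsGT hX] with y hy using hs.jump_eq y hy (hμ.trans hy.1)
  have hbetween : ∀ x, perimeter v < x → X < x → x < X' → ¬ IsRetargetingPosition v p x :=
    fun x h1 h2 h3 => not_isRetargetingPosition (max_lt h2 h1) h3 fun y hy =>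
      hs.jump_eq y ⟨(le_max_left _ _).trans_lt hy.1, hy.2⟩ ((le_max_right _ _).trans_lt hy.1)
  split_ifs with hc
  · obtain ⟨hc1, hc2, hc3⟩ := hc
    refine ⟨?_, ?_, ?_, ?_, ?_, ?_, hdest, hs.value hX⟩
    · rw [List.pairwise_append]
      refine ⟨h.sorted, List.pairwise_singleton _ _, fun a ha b hb => ?_⟩
      rw [List.mem_singleton.1 hb]
      exact (h.window a ha).2.2
    · intro a ha
      rcases List.mem_append.1 ha with ha | ha
      · have := h.window a ha
        exact ⟨this.1, this.2.1, this.2.2.trans hX⟩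
      · rw [List.mem_singleton.1 ha]
        exact ⟨hc2, hc3, hX⟩
    · intro a ha
      rcases List.mem_append.1 ha with ha | ha
      · exact h.retargeting a ha
      · rw [List.mem_singleton.1 ha]
        exact (hret hc2).2 hc1
    · intro a ha
      rcases List.mem_append.1 ha with ha | ha
      · exact h.destination a ha
      · rw [List.mem_singleton.1 ha]
        exact h.destination_last hc2
    · intro a ha
      rcases List.mem_append.1 ha with ha | ha
      · exact h.value a ha
      · rw [List.mem_singleton.1 ha]
        exact h.value_last hc2
    · intro x h1 h2 h3 h4
      rcases lt_trichotomy x X with h5 | h5 | h5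
      · obtain ⟨a, ha, hax⟩ := h.complete x h1 h2 h5 h4
        exact ⟨a, List.mem_append_left _ ha, hax⟩
      · exact ⟨(X, J), by simp, h5.symm⟩
      · exact absurd h4 (hbetween x h1 h5 h3)
  · refine ⟨h.sorted, fun a ha => ?_, h.retargeting, h.destination, h.value, ?_, hdest,
      hs.value hX⟩
    · have := h.window a ha
      exact ⟨this.1, this.2.1, this.2.2.trans hX⟩
    · intro x h1 h2 h3 h4
      rcases lt_trichotomy x X with h5 | h5 | h5
      · exact h.complete x h1 h2 h5 h4
      · rw [h5] at h1 h2 h4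
        exact absurd ⟨(hret h1).1 h4, h1, h2⟩ hc
      · exact absurd h4 (hbetween x h1 h5 h3)

lemma IsRecord.isRetargetingList (hn : 0 < n) (hv : ∀ i : ZMod n, v i ≠ v (i + 1))
    (h : IsRecord v p X J out) (hX : 2 * perimeter v < X) : IsRetargetingList v p out where
  sorted := h.sorted
  period a ha b hb := by
    have h1 := h.window a ha
    have h2 := h.window b hb
    linarith
  complete x := by
    constructor
    · intro hx
      obtain ⟨z, hz, -⟩ := existsUnique_sub_zsmul_mem_Ioc (perimeter_pos hn hv) x (perimeter v)
      rw [zsmul_eq_mul] at hz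
      have h1 := hx.add_period hn hv (-z)
      rw [show x + ((-z : ℤ) : ℝ) * perimeter v = x - z * perimeter v by push_cast; ring] at h1
      obtain ⟨a, ha, hax⟩ := h.complete _ hz.1 (by linarith [hz.2]) (by linarith [hz.2]) h1
      exact ⟨a, ha, z, by rw [hax]; ring⟩
    · rintro ⟨a, ha, z, rfl⟩
      exact (h.retargeting a ha).add_period hn hv z
  destination a ha z := (h.destination a ha).add_period hn hv z
  value := h.value

end record

end
end FeedLink

namespace FeedLink

noncomputable section

open Set

/-! ### The stack of visible segments

The stack lists, from bottom to top, the segments that touch the lower convex hull of the part of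
the plot over `[0, e i]`: the segment `K j` does so for the slopes from `M j` to `M (j + 1)`, and
`Q j` is the value of the conjugate function of the plot at `M j`. -/

/-- The stack, with top in position `r`, after the segments `0, …, i - 1`. -/
structure IsStack (e a : ℤ → ℝ) (i r : ℤ) (K : ℤ → ℤ) (M Q : ℤ → ℝ) : Prop where
  nonneg : 0 ≤ r
  bottom : K 0 = 0
  slope_bottom : M 0 = -2
  idx_lt : ∀ j, 0 ≤ j → j ≤ r → K j < i
  idx_mono : ∀ j, 0 ≤ j → j < r → K j < K (j + 1)
  slope_mono : ∀ j, 0 ≤ j → j < r → M j < M (j + 1)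
  slope_le_one : ∀ j, 0 ≤ j → j ≤ r → M j ≤ 1
  value : ∀ j, 0 ≤ j → j ≤ r → Q j = conj e a (K j) (M j)
  value_pred : ∀ j, 0 ≤ j → j < r → conj e a (K j) (M (j + 1)) = Q (j + 1)
  lower : ∀ j, 0 ≤ j → j ≤ r → ∀ m, M j ≤ m → ∀ l, 0 ≤ l → l < K j →
    conj e a l m ≤ conj e a (K j) m
  upper : ∀ j, 0 ≤ j → j < r → ∀ m < M (j + 1), ∀ l, K j < l → l < i →
    conj e a l m < conj e a (K j) m

/-- `X` is the first point of the `i`-th segment where the plot is not above the line of slope `m`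
that touches the `k`-th segment, and `k` is the last segment to be touched by lines of a smaller
slope. -/
structure IsFront (e a : ℤ → ℝ) (h : ℝ → ℝ) (i k : ℤ) (X m : ℝ) : Prop where
  upper : ∀ m' < m, ∀ l, k < l → l < i → conj e a l m' < conj e a k m'
  upper_le : ∀ l, k < l → l < i → conj e a l m ≤ conj e a k m
  mem : X ∈ Icc (e i) (e (i + 1))
  eq : m * X - h X = conj e a k m
  first : ∀ y ∈ Ico (e i) X, m * y - h y < conj e a k m

/-! ### Pushing and popping -/

namespace IsStack

variable {e a : ℤ → ℝ} {h : ℝ → ℝ} {i r : ℤ} {K : ℤ → ℤ} {M Q : ℤ → ℝ} {X m : ℝ}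

/-- The slope `-2` stands for `-∞`: below `-1` earlier segments win strictly, so segment `0` stays
at the bottom. -/
lemma initial {K : ℤ → ℤ} {M Q : ℤ → ℝ} (hK : K 0 = 0) (hM : M 0 = -2)
    (hQ : Q 0 = conj e a 0 (-2)) : IsStack e a 1 0 K M Q := by
  have h0 : ∀ j : ℤ, 0 ≤ j → j ≤ 0 → j = 0 := fun j h1 h2 => le_antisymm h2 h1
  refine ⟨le_rfl, hK, hM, ?_, ?_, ?_, ?_, ?_, ?_, ?_, ?_⟩
  · intro j h1 h2
    rw [h0 j h1 h2, hK]
    exact one_pos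
  · intro j h1 h2
    omega
  · intro j h1 h2
    omega
  · intro j h1 h2
    rw [h0 j h1 h2, hM]
    norm_num
  · intro j h1 h2
    rw [h0 j h1 h2, hM, hK, hQ]
  · intro j h1 h2
    omega
  · intro j h1 h2 m _ l h3 h4
    rw [h0 j h1 h2, hK] at h4
    omega
  · intro j h1 h2
    omega

lemma idx_nonneg (S : IsStack e a i r K M Q) : ∀ j : ℕ, (j : ℤ) ≤ r → 0 ≤ K j := by
  intro j
  induction j with
  | zero =>
    intro _
    rw [Nat.cast_zero, S.bottom]
  | succ j ih =>
    intro h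
    push_cast at h ⊢
    have := S.idx_mono j (by positivity) (by omega)
    have := ih (by omega)
    omega

lemma top_nonneg (S : IsStack e a i r K M Q) : 0 ≤ K r := by
  have := S.idx_nonneg r.toNat (by rw [Int.toNat_of_nonneg S.nonneg])
  rwa [Int.toNat_of_nonneg S.nonneg] at this

/-- The stack after the top has been removed. -/
lemma pop (S : IsStack e a i r K M Q) (hr : 0 < r) : IsStack e a i (r - 1) K M Q where
  nonneg := by omega
  bottom := S.bottom
  slope_bottom := S.slope_bottom
  idx_lt j h1 h2 := S.idx_lt j h1 (by omega)
  idx_mono j h1 h2 := S.idx_mono j h1 (by omega)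
  slope_mono j h1 h2 := S.slope_mono j h1 (by omega)
  slope_le_one j h1 h2 := S.slope_le_one j h1 (by omega)
  value j h1 h2 := S.value j h1 (by omega)
  value_pred j h1 h2 := S.value_pred j h1 (by omega)
  lower j h1 h2 := S.lower j h1 (by omega)
  upper j h1 h2 := S.upper j h1 (by omega)

/-- The bottom of the stack is never removed. -/
lemma pos_of_le (S : IsStack e a i r K M Q) (H : IsPlot e a h) (h1 : Q r ≤ conj e a i (M r)) :
    0 < r := by
  refine S.nonneg.lt_of_ne fun h0 => ?_
  subst h0
  rw [S.value 0 le_rfl le_rfl] at h1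
  have h2 := S.idx_lt 0 le_rfl le_rfl
  have h3 := H.conj_lt_of_lt_neg_one h2 (show M 0 < -1 by rw [S.slope_bottom]; norm_num)
  linarith

/-- The point `e i` is the right end of segment `i - 1`, whose conjugate at `M r` does not exceed
that of the top. -/
lemma left_le (S : IsStack e a i r K M Q) (H : IsPlot e a h) (F : IsFront e a h i (K r) X m)
    (hm : M r < m) : M r * e i - a i ≤ Q r := by
  rw [S.value r S.nonneg le_rfl]
  have h1 := H.le_conj (m := M r) (H.right_mem (i := i - 1))
  rw [sub_add_cancel, H.apply_eq] at h1
  have h2 := S.idx_lt r S.nonneg le_rfl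
  rcases (show K r ≤ i - 1 by omega).eq_or_lt with h3 | h3
  · rwa [h3]
  · exact h1.trans (F.upper _ hm _ h3 (by omega)).le

lemma hit_spec (S : IsStack e a i r K M Q) (H : IsPlot e a h) (F : IsFront e a h i (K r) X m)
    (hm : M r < m) (h1 : Q r ≤ conj e a i (M r)) :
    hitPos e a i (M r) (Q r) ∈ Icc (e i) (argm e a i (M r)) ∧
      M r * hitPos e a i (M r) (Q r) - h (hitPos e a i (M r) (Q r)) = Q r ∧
      ∀ t ∈ Ico (e i) (hitPos e a i (M r) (Q r)), M r * t - h t < Q r := by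
  refine H.hitPos_spec (S.slope_le_one r S.nonneg le_rfl) (S.left_le H F hm) h1 fun h2 => ?_
  rw [S.value r S.nonneg le_rfl, h2]
  exact H.conj_one_le (S.idx_lt r S.nonneg le_rfl)

/-- The line of slope `M r` with value `Q r` touches both of the two topmost segments, and for
smaller slopes the lower of them beats all later ones. So the same line serves as the front for the
next stack entry. -/
lemma front_pop (S : IsStack e a i r K M Q) (H : IsPlot e a h) (F : IsFront e a h i (K r) X m)
    (hm : M r < m) (h1 : Q r ≤ conj e a i (M r)) :
    IsFront e a h i (K (r - 1)) (hitPos e a i (M r) (Q r)) (M r) := by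
  have hr := S.pos_of_le H h1
  obtain ⟨h2, h3, h4⟩ := S.hit_spec H F hm h1
  have h5 := S.value_pred (r - 1) (by omega) (by omega)
  rw [sub_add_cancel] at h5
  have h6 := S.upper (r - 1) (by omega) (by omega)
  rw [sub_add_cancel] at h6
  refine ⟨h6, ?_, ⟨h2.1, h2.2.trans H.argm_mem.2⟩, by rw [h3, h5], by rwa [h5]⟩
  intro l hl1 hl2
  rw [h5, S.value r S.nonneg le_rfl]
  have h0 := (S.pop hr).top_nonneg
  rcases lt_trichotomy l (K r) with h7 | h7 | h7
  · exact S.lower r S.nonneg le_rfl _ le_rfl l (by omega) h7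
  · rw [h7]
  · exact (F.upper _ hm l h7 hl2).le

/-- The new segment has the largest conjugate function at slopes above that of the common
tangent. -/
lemma lower_push (S : IsStack e a i r K M Q) (H : IsPlot e a h) (F : IsFront e a h i (K r) X m)
    (h1 : conj e a i (M r) < Q r) (m' : ℝ) (hm' : tangentSlope e a (K r) i ≤ m') (l : ℤ)
    (hl0 : 0 ≤ l) (hli : l < i) : conj e a l m' ≤ conj e a i m' := by
  rw [S.value r S.nonneg le_rfl] at h1
  have hki := S.idx_lt r S.nonneg le_rfl
  obtain ⟨h2, h3, h4, h5⟩ := H.tangentSlope_spec hki h1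
  -- The front line meets segment `i` at `X`, so at the slope `m` the conjugate of `i` has already
  -- caught up with that of the top.
  have hle : tangentSlope e a (K r) i ≤ m := by
    rw [← h5, ← F.eq]
    exact H.le_conj F.mem
  have h6 := H.conj_sub_conj_mono hli hm'
  suffices conj e a l (tangentSlope e a (K r) i) ≤ conj e a (K r) (tangentSlope e a (K r) i) by
    linarith
  rcases lt_trichotomy l (K r) with h7 | h7 | h7
  · exact S.lower r S.nonneg le_rfl _ h2.le l hl0 h7
  · rw [h7]
  · rcases hle.eq_or_lt with h8 | h8
    · rw [h8]
      exact F.upper_le l h7 hli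
    · exact (F.upper _ h8 l h7 hli).le

/-- The stack after a segment has been added. -/
lemma push (S : IsStack e a i r K M Q) (H : IsPlot e a h) (F : IsFront e a h i (K r) X m)
    (h1 : conj e a i (M r) < Q r) :
    IsStack e a (i + 1) (r + 1) (Function.update K (r + 1) i)
      (Function.update M (r + 1) (tangentSlope e a (K r) i))
      (Function.update Q (r + 1) (conj e a i (tangentSlope e a (K r) i))) := by
  have hlow := S.lower_push H F h1
  rw [S.value r S.nonneg le_rfl] at h1
  have hki := S.idx_lt r S.nonneg le_rfl
  obtain ⟨h2, h3, h4, h5⟩ := H.tangentSlope_spec hki h1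
  have hle : tangentSlope e a (K r) i ≤ m := by
    rw [← h5, ← F.eq]
    exact H.le_conj F.mem
  have h0 := S.nonneg
  set m' := tangentSlope e a (K r) i
  have hK : ∀ j, j ≤ r → Function.update K (r + 1) i j = K j := fun j hj =>
    Function.update_of_ne (by omega) _ _
  have hM : ∀ j, j ≤ r → Function.update M (r + 1) m' j = M j := fun j hj =>
    Function.update_of_ne (by omega) _ _
  have hQ : ∀ j, j ≤ r → Function.update Q (r + 1) (conj e a i m') j = Q j := fun j hj =>
    Function.update_of_ne (by omega) _ _
  have hlt : ∀ x, x < m' → conj e a i x < conj e a (K r) x := fun x hx => by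
    by_contra! hge
    exact absurd ((h5 x).1 hge) (not_le.2 hx)
  refine ⟨by omega, ?_, ?_, ?_, ?_, ?_, ?_, ?_, ?_, ?_, ?_⟩
  · rw [hK 0 h0, S.bottom]
  · rw [hM 0 h0, S.slope_bottom]
  · intro j hj1 hj2
    rcases hj2.eq_or_lt with rfl | hj
    · rw [Function.update_self]
      omega
    · rw [hK j (by omega)]
      have := S.idx_lt j hj1 (by omega)
      omega
  · intro j hj1 hj2
    rw [hK j (by omega)]
    rcases (show j ≤ r by omega).eq_or_lt with rfl | hj
    · rwa [Function.update_self]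
    · rw [hK (j + 1) (by omega)]
      exact S.idx_mono j hj1 hj
  · intro j hj1 hj2
    rw [hM j (by omega)]
    rcases (show j ≤ r by omega).eq_or_lt with rfl | hj
    · rwa [Function.update_self]
    · rw [hM (j + 1) (by omega)]
      exact S.slope_mono j hj1 hj
  · intro j hj1 hj2
    rcases hj2.eq_or_lt with rfl | hj
    · rwa [Function.update_self]
    · rw [hM j (by omega)]
      exact S.slope_le_one j hj1 (by omega)
  · intro j hj1 hj2
    rcases hj2.eq_or_lt with rfl | hj
    · simp only [Function.update_self]
    · rw [hM j (by omega), hQ j (by omega), hK j (by omega)]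
      exact S.value j hj1 (by omega)
  · intro j hj1 hj2
    rw [hK j (by omega)]
    rcases (show j ≤ r by omega).eq_or_lt with rfl | hj
    · simp only [Function.update_self]
      exact h4.symm
    · rw [hM (j + 1) (by omega), hQ (j + 1) (by omega)]
      exact S.value_pred j hj1 hj
  · intro j hj1 hj2
    rcases hj2.eq_or_lt with rfl | hj
    · simp only [Function.update_self]
      exact hlow
    · rw [hM j (by omega), hK j (by omega)]
      exact S.lower j hj1 (by omega)
  · intro j hj1 hj2
    rw [hK j (by omega)]
    rcases (show j ≤ r by omega).eq_or_lt with rfl | hj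
    · rw [Function.update_self]
      intro x hx l hl1 hl2
      rcases (show l ≤ i by omega).eq_or_lt with rfl | hl
      · exact hlt x hx
      · exact F.upper x (hx.trans_le hle) l hl1 hl
    · rw [hM (j + 1) (by omega)]
      intro x hx l hl1 hl2
      rcases (show l ≤ i by omega).eq_or_lt with rfl | hl
      · have hmono : ∀ d : ℕ, j + 1 + d ≤ r → M (j + 1) ≤ M (j + 1 + d) ∧ K j < K (j + 1 + d) := by
          intro d
          induction d with
          | zero =>
            intro _
            rw [Nat.cast_zero, add_zero]
            exact ⟨le_rfl, S.idx_mono j hj1 hj⟩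
          | succ d ih =>
            intro hd
            push_cast at hd ⊢
            have h6 := ih (by omega)
            have h7 := S.slope_mono (j + 1 + d) (by omega) (by omega)
            have h8 := S.idx_mono (j + 1 + d) (by omega) (by omega)
            rw [← add_assoc]
            exact ⟨h6.1.trans h7.le, h6.2.trans h8⟩
        have h6 := hmono (r - (j + 1)).toNat (by omega)
        rw [show j + 1 + ((r - (j + 1)).toNat : ℤ) = r by omega] at h6
        refine (hlt x (by linarith [h6.1])).trans ?_
        exact S.upper j hj1 hj x hx (K r) h6.2 hki
      · exact S.upper j hj1 hj x hx l hl1 hl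

end IsStack

/-- The slope `2` stands for `+∞`: a line of slope above `1` supports segment `i` at its right end,
where the next segment starts. -/
lemma IsPlot.front_init {e a : ℤ → ℝ} {h : ℝ → ℝ} (H : IsPlot e a h) (i : ℤ) :
    IsFront e a h (i + 1) i (e (i + 1)) 2 where
  upper m _ l h1 h2 := by omega
  upper_le l h1 h2 := by omega
  mem := H.left_mem
  eq := by rw [H.conj_of_one_lt one_lt_two, H.apply_eq]
  first y hy := absurd hy.2 hy.1.not_gt

/-! ### Stretches with constant jump destination -/

section span

variable {n : ℕ} {v : ZMod n → Plane} {p : Plane} {i r : ℤ} {K : ℤ → ℤ} {M Q : ℤ → ℝ}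
  {X X' m m' : ℝ} (hn : 0 < n) (hv : ∀ i : ZMod n, v i ≠ v (i + 1))

local notation "ε" => breakpoint v
local notation "α" => fun i => distFun v p (breakpoint v i)

include hn hv

/-- For `y` between `X` and `X'`, the difference of `conj (K r)` and `x y - h y` changes sign as the
slope `x` runs from `m'` to `m`, so some line through `H(y)` with such a slope touches `K r`. For
slopes in `[M r, m)` the stack and the front make `K r` the last maximizer. -/
lemma isSpan_of_front (S : IsStack ε α i r K M Q) (F : IsFront ε α (distFun v p) i (K r) X m)
    (hm1 : M r ≤ m') (hm2 : m' ≤ m) (hX : X' ∈ Icc (ε i) (ε (i + 1)))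
    (hX' : m' * X' - distFun v p X' = conj ε α (K r) m')
    (hmono : StrictMonoOn (fun t => m' * t - distFun v p t) (Icc (ε i) X')) :
    IsSpan v p X X' (K r) := by
  have H := isPlot hn hv p
  have hki := S.idx_lt r S.nonneg le_rfl
  have hke : ε (K r + 1) ≤ ε i := H.mono_lt hki
  have hle : X ≤ X' := by
    by_contra! hlt
    have h1 := F.first X' ⟨hX.1, hlt⟩
    have h2 := H.conj_sub_le (i := K r) hm2
    nlinarith [hX.1]
  have hjump : ∀ y ∈ Ioc X X', perimeter v < y → jump v p y = K r := by
    intro y hy hμ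
    have hyi : ε i < y := F.mem.1.trans_lt hy.1
    have hyX : y ∈ Icc (ε i) X' := ⟨hyi.le, hy.2⟩
    have hXX : X' ∈ Icc (ε i) X' := ⟨hX.1, le_rfl⟩
    have hcont : ContinuousOn (fun x => conj ε α (K r) x - (x * y - distFun v p y))
        (Icc m' m) := by
      have := H.continuous_conj (i := K r)
      fun_prop
    have hψ0 : m' * y - distFun v p y ≤ conj ε α (K r) m' := by
      rw [← hX']
      exact hmono.monotoneOn hyX hXX hy.2
    have hψ1 : conj ε α (K r) m < m * y - distFun v p y := by
      rw [← F.eq]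
      have := hmono ⟨F.mem.1, hle⟩ hyX hy.1
      simp only at this
      nlinarith [hy.1]
    obtain ⟨x, hx1, hx2⟩ := intermediate_value_Icc' hm2 hcont
      (show (0 : ℝ) ∈ Icc _ _ from ⟨by linarith, by linarith⟩)
    simp only at hx2
    have hxm : x < m := hx1.2.lt_of_ne (by
      rintro rfl
      linarith)
    refine jump_eq_of_tangent hn hv (i := i) (m := x) ⟨hyi, hy.2.trans hX.2⟩ hki hμ.le (by linarith)
      (fun l hl0 hl => S.lower r S.nonneg le_rfl x (hm1.trans hx1.1) l hl0 hl)
      (fun l hl1 hl2 => F.upper x hxm l hl1 hl2) fun s hs => ?_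
    have := hmono ⟨hs.1, hs.2.le.trans hy.2⟩ hyX hs.2
    simp only at this
    nlinarith [hx1.1, hs.2]
  exact ⟨hle, fun y hy => hjump y ⟨hy.1, hy.2.le⟩, fun h1 h2 => .inl (hjump X' ⟨h1, le_rfl⟩ h2)⟩

lemma isSpan_pop (S : IsStack ε α i r K M Q) (F : IsFront ε α (distFun v p) i (K r) X m)
    (hm : M r < m) (h1 : Q r ≤ conj ε α i (M r)) :
    IsSpan v p X (hitPos ε α i (M r) (Q r)) (K r) := by
  have H := isPlot hn hv p
  obtain ⟨h2, h3, h4⟩ := S.hit_spec H F hm h1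
  refine isSpan_of_front hn hv S F le_rfl hm.le ⟨h2.1, h2.2.trans H.argm_mem.2⟩
    (h3.trans (S.value r S.nonneg le_rfl)) ?_
  exact (H.strictMonoOn (S.slope_le_one r S.nonneg le_rfl)).mono (Icc_subset_Icc_right h2.2)

lemma isSpan_push (S : IsStack ε α i r K M Q) (F : IsFront ε α (distFun v p) i (K r) X m)
    (h1 : conj ε α i (M r) < Q r) :
    IsSpan v p X (argm ε α i (tangentSlope ε α (K r) i)) (K r) := by
  have H := isPlot hn hv p
  rw [S.value r S.nonneg le_rfl] at h1
  obtain ⟨h2, h3, h4, h5⟩ := H.tangentSlope_spec (S.idx_lt r S.nonneg le_rfl) h1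
  refine isSpan_of_front hn hv S F h2.le ?_ H.argm_mem ?_ (H.strictMonoOn h3)
  · rw [← h5, ← F.eq]
    exact H.le_conj F.mem
  · rw [← H.conj_eq, h4]

/-- The common tangent touches segment `i` at `argm` and supports the plot over all of `[0, e (i +
1)]`, as `lower_push` shows. So no ray from a later point of the segment has its rightmost contact
before `argm`. -/
lemma isSpan_self (S : IsStack ε α i r K M Q) (F : IsFront ε α (distFun v p) i (K r) X m)
    (h1 : conj ε α i (M r) < Q r) :
    IsSpan v p (argm ε α i (tangentSlope ε α (K r) i)) (ε (i + 1)) i := by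
  have H := isPlot hn hv p
  have hlow := S.lower_push H F h1
  set m' := tangentSlope ε α (K r) i
  have hmem := H.argm_mem (i := i) (m := m')
  have hself : ∀ y ∈ Ioc (argm ε α i m') (ε (i + 1)), perimeter v < y →
      jump v p y = i ∨ y = ε (i + 1) ∧ jump v p y = i + 1 := by
    intro y hy hμ
    refine jump_eq_self hn hv (m := m') hmem.1 hy hμ.le fun s hs => ?_
    rw [← H.conj_eq]
    rcases le_or_gt (ε i) s with hsi | hsi
    · exact H.le_conj ⟨hsi, hs.2.trans hy.2⟩
    · exact (H.le_conj (Ico_subset_Icc_self (segIdx_spec hn hv s))).trans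
        (hlow m' le_rfl _ (segIdx_nonneg hn hv hs.1) (segIdx_lt hn hv hsi))
  refine ⟨hmem.2, fun y hy hμ => ?_, fun h2 hμ => hself _ ⟨h2, le_rfl⟩ hμ⟩
  rcases hself y ⟨hy.1, hy.2.le⟩ hμ with h2 | h2
  · exact h2
  · exact absurd h2.1 hy.2.ne

end span

end
end FeedLink

namespace RealRAM

noncomputable section

/-! ### Running programs -/

/-- A program without loops. -/
def Program.LoopFree : Program → Prop
  | .skip => True
  | .setI _ _ _ => True
  | .setR _ _ _ => True
  | .seq c d => c.LoopFree ∧ d.LoopFree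
  | .ite _ c d => c.LoopFree ∧ d.LoopFree
  | .loop _ _ => False

open Classical in
/-- The final state of a program without loops. -/
def Program.run : Program → State → State
  | .skip, s => s
  | .setI a i e, s => s.writeI a (i.eval s) (e.eval s)
  | .setR a i e, s => s.writeR a (i.eval s) (e.eval s)
  | .seq c d, s => d.run (c.run s)
  | .ite b c d, s => if b.eval s then c.run s else d.run s
  | .loop _ _, s => s

/-- A bound for the number of steps of a program without loops. -/
def Program.maxCost : Program → ℕ
  | .skip => 1
  | .setI _ i e => i.cost + e.cost + 1
  | .setR _ i e => i.cost + e.cost + 1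
  | .seq c d => c.maxCost + d.maxCost
  | .ite b c d => b.cost + (c.maxCost + d.maxCost) + 1
  | .loop _ _ => 0

lemma Program.LoopFree.exec {c : Program} (hc : c.LoopFree) (s : State) :
    ∃ t ≤ c.maxCost, Exec c s (c.run s) t := by
  induction c generalizing s with
  | skip => exact ⟨1, le_rfl, .skip s⟩
  | setI a i e => exact ⟨_, le_rfl, .setI a i e s⟩
  | setR a i e => exact ⟨_, le_rfl, .setR a i e s⟩
  | seq c d ihc ihd =>
    obtain ⟨t, ht, h1⟩ := ihc hc.1 s
    obtain ⟨u, hu, h2⟩ := ihd hc.2 (c.run s)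
    exact ⟨t + u, Nat.add_le_add ht hu, .seq h1 h2⟩
  | ite b c d ihc ihd =>
    by_cases hb : b.eval s
    · obtain ⟨t, ht, h1⟩ := ihc hc.1 s
      refine ⟨b.cost + t + 1, ?_, ?_⟩
      · simp only [Program.maxCost]
        omega
      · rw [Program.run, if_pos hb]
        exact .ite_true hb h1
    · obtain ⟨t, ht, h1⟩ := ihd hc.2 s
      refine ⟨b.cost + t + 1, ?_, ?_⟩
      · simp only [Program.maxCost]
        omega
      · rw [Program.run, if_neg hb]
        exact .ite_false hb h1
  | loop b c _ => exact hc.elim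

/-- A loop whose body preserves `I` and decreases the potential `Φ`. -/
lemma exec_loop {b : BExp} {c : Program} (hc : c.LoopFree) (I : State → Prop) (Φ : State → ℕ)
    (h : ∀ s, I s → b.eval s → I (c.run s) ∧ Φ (c.run s) < Φ s) (s : State) (hs : I s) :
    ∃ s' t, Exec (.loop b c) s s' t ∧ I s' ∧ ¬ b.eval s' ∧
      t ≤ (Φ s + 1) * (b.cost + c.maxCost + 1) := by
  induction hΦ : Φ s using Nat.strong_induction_on generalizing s with
  | _ N ih =>
    by_cases hb : b.eval s
    · obtain ⟨h1, h2⟩ := h s hs hb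
      obtain ⟨t, ht, h3⟩ := hc.exec s
      obtain ⟨s', u, h4, h5, h6, h7⟩ := ih _ (hΦ ▸ h2) (c.run s) h1 rfl
      refine ⟨s', _, .loop_step hb h3 h4, h5, h6, ?_⟩
      have h8 : Φ (c.run s) + 1 ≤ N := hΦ ▸ h2
      have h9 := Nat.mul_le_mul_right (b.cost + c.maxCost + 1) h8
      rw [add_one_mul]
      omega
    · refine ⟨s, _, .loop_done hb, hs, hb, ?_⟩
      rw [add_one_mul]
      omega

/-! ### Memory contents after a write -/

lemma real_writeR (s : State) (a b : ℕ) (i : ℤ) (x : ℝ) :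
    (s.writeR a i x).real b = if b = a then Function.update (s.real a) i x else s.real b := by
  simp only [State.writeR, Function.update_apply]

lemma int_writeI (s : State) (a b : ℕ) (i x : ℤ) :
    (s.writeI a i x).int b = if b = a then Function.update (s.int a) i x else s.int b := by
  simp only [State.writeI, Function.update_apply]

lemma int_writeR (s : State) (a : ℕ) (i : ℤ) (x : ℝ) : (s.writeR a i x).int = s.int := rfl

lemma real_writeI (s : State) (a : ℕ) (i x : ℤ) : (s.writeI a i x).real = s.real := rfl

lemma writeR_writeR (s : State) (a : ℕ) (i : ℤ) (x y : ℝ) :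
    (s.writeR a i x).writeR a i y = s.writeR a i y := by
  simp [State.writeR]

lemma IExp.eval_congr (e : IExp) {s s' : State} (h : s'.int = s.int) : e.eval s' = e.eval s := by
  induction e with
  | const c => rfl
  | get b j ih => simp only [IExp.eval, ih, h]
  | add e f h1 h2 => simp only [IExp.eval, h1, h2]
  | sub e f h1 h2 => simp only [IExp.eval, h1, h2]

lemma IExp.eval_writeR (e : IExp) (s : State) (a : ℕ) (i : ℤ) (x : ℝ) :
    e.eval (s.writeR a i x) = e.eval s := e.eval_congr rfl

end

end RealRAM

namespace FeedLink

/-! ### Locality of the geometric operations -/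

section congr

variable {e a e' a' : ℤ → ℝ} {i j k : ℤ} {m q : ℝ}

/-- The data of the `i`-th segment agree. -/
def SameData (e a e' a' : ℤ → ℝ) (i : ℤ) : Prop :=
  e i = e' i ∧ e (i + 1) = e' (i + 1) ∧ a i = a' i ∧ a (i + 1) = a' (i + 1)

/-- The memory agrees with the plot only over three periods. All formulas read just the two ends of
a segment, so this is enough. -/
lemma SameData.foot (h : SameData e a e' a' i) : foot e a i = foot e' a' i := by
  obtain ⟨h1, h2, h3, h4⟩ := h
  simp only [FeedLink.foot, h1, h2, h3, h4]

lemma SameData.height (h : SameData e a e' a' i) : height e a i = height e' a' i := by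
  simp only [FeedLink.height, h.foot, h.1, h.2.2.1]

lemma SameData.slopeL (h : SameData e a e' a' i) : slopeL e a i = slopeL e' a' i := by
  simp only [FeedLink.slopeL, h.foot, h.1, h.2.2.1]

lemma SameData.slopeR (h : SameData e a e' a' i) : slopeR e a i = slopeR e' a' i := by
  simp only [FeedLink.slopeR, h.foot, h.2.1, h.2.2.2]

lemma SameData.argm (h : SameData e a e' a' i) : argm e a i m = argm e' a' i m := by
  simp only [FeedLink.argm, h.foot, h.height, h.slopeL, h.slopeR, h.1, h.2.1]

lemma SameData.conj (h : SameData e a e' a' i) : conj e a i m = conj e' a' i m := by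
  simp only [FeedLink.conj, h.argm, h.foot, h.height]

lemma SameData.piece (hk : SameData e a e' a' k) (hi : SameData e a e' a' i)
    (hj : SameData e a e' a' j) : piece e a k i j = piece e' a' k i j := by
  simp only [FeedLink.piece, hk.conj, hi.conj, hj.foot, hj.height, hj.slopeL, hj.slopeR, hj.1,
    hj.2.1, hj.2.2.1, hj.2.2.2]

lemma SameData.tangentSlope (hk : SameData e a e' a' k) (hi : SameData e a e' a' i) :
    tangentSlope e a k i = tangentSlope e' a' k i := by
  simp only [FeedLink.tangentSlope, hk.piece hi hk, hk.piece hi hi]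

lemma SameData.hitPos (h : SameData e a e' a' i) : hitPos e a i m q = hitPos e' a' i m q := by
  simp only [FeedLink.hitPos, h.foot, h.height, h.1, h.2.2.1]

end congr

end FeedLink

namespace RealRAM

open FeedLink

/-! ### Building blocks of the program

The program uses the following arrays besides those for input and output.

Integers: `3` the number `3 n`; `4` the current segment; `5` its residue; `6` the segments on the
stack; `7` the position of the top of the stack; `8` the jump destination on the left of the last
position.

Reals: `4` the breakpoints; `5` the values of the plot there; `6` and `7` the slopes and values on
the stack; `8` the last position; `9` the next position; `10`, …, `14` temporary values. -/

section blocks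

/-- A variable. -/
abbrev ivar (a : ℕ) : IExp := .get a (.const 0)

/-- A variable. -/
abbrev rvar (a : ℕ) : RExp := .get a (.const 0)

/-- The expression `i + 1`. -/
abbrev succX (i : IExp) : IExp := .add i (.const 1)

/-- The `i`-th breakpoint. -/
abbrev breakX (i : IExp) : RExp := .get 4 i

/-- The value at the `i`-th breakpoint. -/
abbrev valueX (i : IExp) : RExp := .get 5 i

/-- The square of an expression. -/
abbrev sqX (e : RExp) : RExp := .mul e e

/-- The length of the `i`-th side. -/
abbrev lengthX (i : IExp) : RExp := .sub (breakX (succX i)) (breakX i)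

def footX (i : IExp) : RExp :=
  .add (breakX i) (.div (.add (.sub (sqX (valueX i)) (sqX (valueX (succX i)))) (sqX (lengthX i)))
    (.mul (.const 2) (lengthX i)))

def heightX (i : IExp) : RExp :=
  .sqrt (.sub (sqX (valueX i)) (sqX (.sub (breakX i) (footX i))))

def slopeLX (i : IExp) : RExp := .div (.sub (breakX i) (footX i)) (valueX i)

def slopeRX (i : IExp) : RExp := .div (.sub (breakX (succX i)) (footX i)) (valueX (succX i))

/-- The expression `1 - m²`. -/
abbrev cosqX (m : RExp) : RExp := .sub (.const 1) (sqX m)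

/-- Computes `argm`. -/
def argP (i : IExp) (m : RExp) (b : ℕ) : Program :=
  .ite (.leR m (slopeLX i)) (.setR b (.const 0) (breakX i))
    (.ite (.leR m (slopeRX i))
      (.setR b (.const 0)
        (.add (footX i) (.div (.mul (heightX i) m) (.sqrt (cosqX m)))))
      (.setR b (.const 0) (breakX (succX i))))

/-- Computes `conj`. -/
def conjP (i : IExp) (m : RExp) (b : ℕ) : Program :=
  .seq (argP i m b)
    (.setR b (.const 0) (.sub (.mul m (rvar b))
      (.sqrt (.add (sqX (.sub (rvar b) (footX i))) (sqX (heightX i))))))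

/-- Writes the first three cells of an array. -/
def tripleP (b : ℕ) (x y z : RExp) : Program :=
  .seq (.setR b (.const 0) x) (.seq (.setR b (.const 1) y) (.setR b (.const 2) z))

/-- Computes `piece`. -/
def pieceP (k i j : IExp) (b : ℕ) : Program :=
  .seq (conjP k (slopeLX j) 10) (.seq (conjP i (slopeLX j) 11)
    (.ite (.leR (rvar 10) (rvar 11)) (tripleP b (breakX j) (.const 0) (valueX j))
      (.seq (conjP k (slopeRX j) 10) (.seq (conjP i (slopeRX j) 11)
        (.ite (.leR (rvar 10) (rvar 11)) (tripleP b (footX j) (heightX j) (.const 0))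
          (tripleP b (breakX (succX j)) (.const 0) (valueX (succX j))))))))

/-- The difference of two cells. -/
abbrev diffX (i : ℤ) : RExp := .sub (.get 13 (.const i)) (.get 12 (.const i))

/-- Computes `tangentSlope`. -/
def tangentP (k i : IExp) : Program :=
  .seq (pieceP k i k 12) (.seq (pieceP k i i 13)
    (.setR 14 (.const 0)
      (.div (.add (.mul (diffX 0) (diffX 2)) (.mul (diffX 1) (.sqrt
        (.sub (.add (sqX (diffX 0)) (sqX (diffX 1))) (sqX (diffX 2))))))
        (.add (sqX (diffX 0)) (sqX (diffX 1))))))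

/-- The expression `m c - q`. -/
abbrev lineX (i : IExp) (m q : RExp) : RExp := .sub (.mul m (footX i)) q

/-- Computes `hitPos`. -/
def hitP (i : IExp) (m q : RExp) : Program :=
  .ite (.leR q (.sub (.mul m (breakX i)) (valueX i))) (.setR 9 (.const 0) (breakX i))
    (.setR 9 (.const 0) (.add (footX i) (.div (.sub (.mul m (lineX i m q))
      (.sqrt (.sub (sqX (lineX i m q)) (.mul (cosqX m) (sqX (heightX i)))))) (cosqX m))))

variable (s : State) (i j k : IExp) (m q : RExp) {b : ℕ}

@[simp] lemma eval_footX : (footX i).eval s = foot (s.real 4) (s.real 5) (i.eval s) := by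
  simp [footX, RExp.eval, IExp.eval, foot]

@[simp] lemma eval_heightX : (heightX i).eval s = height (s.real 4) (s.real 5) (i.eval s) := by
  simp [heightX, RExp.eval, height]

@[simp] lemma eval_slopeLX : (slopeLX i).eval s = slopeL (s.real 4) (s.real 5) (i.eval s) := by
  simp [slopeLX, RExp.eval, slopeL]

@[simp] lemma eval_slopeRX : (slopeRX i).eval s = slopeR (s.real 4) (s.real 5) (i.eval s) := by
  simp [slopeRX, RExp.eval, IExp.eval, slopeR]

lemma run_argP : (argP i m b).run s =
    s.writeR b 0 (argm (s.real 4) (s.real 5) (i.eval s) (m.eval s)) := by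
  simp only [argP, Program.run, BExp.eval, eval_slopeLX, eval_slopeRX, argm]
  split_ifs <;> simp [RExp.eval, IExp.eval]

/-- The target cell first holds `argm`, so neither the slope expression nor the plot data may depend
on it. -/
lemma run_conjP (h4 : 4 ≠ b) (h5 : 5 ≠ b) (hm : ∀ x, m.eval (s.writeR b 0 x) = m.eval s) :
    (conjP i m b).run s =
      s.writeR b 0 (FeedLink.conj (s.real 4) (s.real 5) (i.eval s) (m.eval s)) := by
  simp only [conjP, Program.run, run_argP]
  simp [RExp.eval, IExp.eval, hm, real_writeR, h4, h5, IExp.eval_writeR, writeR_writeR,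
    FeedLink.conj, curve, pow_two]

lemma run_tripleP (x y z : RExp)
    (hy : ∀ w, y.eval (s.writeR b 0 w) = y.eval s)
    (hz : ∀ w w', z.eval ((s.writeR b 0 w).writeR b 1 w') = z.eval s) :
    (tripleP b x y z).run s =
      ((s.writeR b 0 (x.eval s)).writeR b 1 (y.eval s)).writeR b 2 (z.eval s) := by
  simp [tripleP, Program.run, IExp.eval, hy, hz]

/-- The effect of a block that changes only some real arrays. -/
structure Changes (s s' : State) (l : List ℕ) : Prop where
  int : s'.int = s.int
  real : ∀ a, a ∉ l → s'.real a = s.real a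

lemma pieceP_spec (hb : b = 12 ∨ b = 13) : Changes s ((pieceP k i j b).run s) [10, 11, b] ∧
    (((pieceP k i j b).run s).real b 0, ((pieceP k i j b).run s).real b 1,
      ((pieceP k i j b).run s).real b 2) =
      piece (s.real 4) (s.real 5) (k.eval s) (i.eval s) (j.eval s) := by
  have h4 : 4 ≠ b := by omega
  have h5 : 5 ≠ b := by omega
  have hcL : ∀ (s : State) (i j : IExp) (c : ℕ), c = 10 ∨ c = 11 →
      (conjP i (slopeLX j) c).run s = s.writeR c 0 (FeedLink.conj (s.real 4) (s.real 5) (i.eval s)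
        (slopeL (s.real 4) (s.real 5) (j.eval s))) := by
    intro s i j c hc
    have h4 : 4 ≠ c := by omega
    have h5 : 5 ≠ c := by omega
    rw [run_conjP s i _ h4 h5 (by simp [real_writeR, h4, h5, IExp.eval_writeR]), eval_slopeLX]
  have hcR : ∀ (s : State) (i j : IExp) (c : ℕ), c = 10 ∨ c = 11 →
      (conjP i (slopeRX j) c).run s = s.writeR c 0 (FeedLink.conj (s.real 4) (s.real 5) (i.eval s)
        (slopeR (s.real 4) (s.real 5) (j.eval s))) := by
    intro s i j c hc
    have h4 : 4 ≠ c := by omega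
    have h5 : 5 ≠ c := by omega
    rw [run_conjP s i _ h4 h5 (by simp [real_writeR, h4, h5, IExp.eval_writeR]), eval_slopeRX]
  have e1 : (10 : ℕ) ≠ b := by omega
  have e2 : (11 : ℕ) ≠ b := by omega
  simp only [pieceP, Program.run, hcL _ _ _ 10 (.inl rfl), hcL _ _ _ 11 (.inr rfl),
    hcR _ _ _ 10 (.inl rfl), hcR _ _ _ 11 (.inr rfl), BExp.eval, piece]
  simp only [RExp.eval, IExp.eval, IExp.eval_writeR, real_writeR]
  simp only [Nat.reduceEqDiff, ↓reduceIte, Function.update_self]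
  split_ifs
  all_goals
    rw [run_tripleP _ _ _ _
      (by intros; simp [RExp.eval, real_writeR, h4, h5, IExp.eval_writeR])
      (by intros; simp [RExp.eval, IExp.eval, real_writeR, h5, IExp.eval_writeR])]
    refine ⟨⟨rfl, fun a ha => ?_⟩, ?_⟩
    · simp only [List.mem_cons, List.not_mem_nil, or_false, not_or] at ha
      simp [real_writeR, ha]
    · simp [real_writeR, RExp.eval, IExp.eval, IExp.eval_writeR]

lemma tangentP_spec : Changes s ((tangentP k i).run s) [10, 11, 12, 13, 14] ∧
    ((tangentP k i).run s).real 14 0 =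
      tangentSlope (s.real 4) (s.real 5) (k.eval s) (i.eval s) := by
  obtain ⟨h1, h2⟩ := pieceP_spec s i k k (b := 12) (.inl rfl)
  obtain ⟨h3, h4⟩ := pieceP_spec ((pieceP k i k 12).run s) i i k (b := 13) (.inr rfl)
  have hev : ∀ e : IExp, e.eval ((pieceP k i k 12).run s) = e.eval s :=
    fun e => e.eval_congr h1.int
  rw [hev, hev, h1.real 4 (by simp), h1.real 5 (by simp)] at h4
  simp only [tangentP, Program.run]
  set s₁ := (pieceP k i k 12).run s
  set s₂ := (pieceP k i i 13).run s₁
  refine ⟨⟨h3.int.trans h1.int, fun a ha => ?_⟩, ?_⟩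
  · simp only [List.mem_cons, List.not_mem_nil, or_false, not_or] at ha
    rw [real_writeR, if_neg ha.2.2.2.2, h3.real a (by simp [ha]), h1.real a (by simp [ha])]
  · simp only [real_writeR, if_true, RExp.eval, IExp.eval, Function.update_self, tangentSlope,
      solveSlope, ← h2, ← h4, h3.real 12 (by simp)]

lemma run_hitP : (hitP i m q).run s =
    s.writeR 9 0 (hitPos (s.real 4) (s.real 5) (i.eval s) (m.eval s) (q.eval s)) := by
  simp only [hitP, Program.run, BExp.eval, hitPos]
  simp only [RExp.eval, eval_footX, eval_heightX, IExp.eval, Int.cast_one]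
  split_ifs <;> simp

/-- Passes from the last position to the next one, where the stack has its top in cell `i`. -/
def nextP : Program :=
  .ite (.not (.leR (rvar 9) (rvar 8)))
    (.seq
      (.ite (.and (.not (.and (.leI (ivar 8) (.get 6 (ivar 7))) (.leI (.get 6 (ivar 7)) (ivar 8))))
          (.and (.not (.leR (rvar 8) (breakX (ivar 0))))
            (.leR (rvar 8) (breakX (.add (ivar 0) (ivar 0))))))
        (.seq (.setR 3 (ivar 1) (rvar 8)) (.seq (.setI 2 (ivar 1) (ivar 8))
          (.setI 1 (.const 0) (succX (ivar 1)))))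
        .skip)
      (.seq (.setR 8 (.const 0) (rvar 9)) (.setI 8 (.const 0) (.get 6 (ivar 7)))))
    .skip

lemma outputList_eq (s : State) : outputList s =
    (List.range (s.int 1 0).toNat).map fun k : ℕ => (s.real 3 k, s.int 2 k) := by
  simp [outputList, List.map_eq_flatMap, List.flatMap_assoc]

lemma outputList_append {s s' : State} (h0 : 0 ≤ s.int 1 0) (h1 : s'.int 1 0 = s.int 1 0 + 1)
    {x : ℝ} {j : ℤ} (h2 : s'.real 3 = Function.update (s.real 3) (s.int 1 0) x)
    (h3 : s'.int 2 = Function.update (s.int 2) (s.int 1 0) j) :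
    outputList s' = outputList s ++ [(x, j)] := by
  have h4 : (s'.int 1 0).toNat = (s.int 1 0).toNat + 1 := by omega
  have h5 : ((s.int 1 0).toNat : ℤ) = s.int 1 0 := Int.toNat_of_nonneg h0
  rw [outputList_eq, h4, List.range_succ, List.map_append, outputList_eq, List.map_singleton, h2, h3, h5,
    Function.update_self, Function.update_self]
  congr 1
  refine List.map_congr_left fun k hk => ?_
  rw [List.mem_range] at hk
  rw [Function.update_of_ne (by omega), Function.update_of_ne (by omega)]

lemma outputList_congr {s s' : State} (h1 : s'.int 1 = s.int 1) (h2 : s'.int 2 = s.int 2)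
    (h3 : s'.real 3 = s.real 3) : outputList s' = outputList s := by
  simp only [outputList, h1, h2, h3]

/-- The effect of `nextP`. -/
structure IsNext {n : ℕ} (v : ZMod n → Plane) (p : Plane) (s s' : State) : Prop where
  int : ∀ a, a ∉ [1, 2, 8] → s'.int a = s.int a
  real : ∀ a, a ∉ [3, 8] → s'.real a = s.real a
  position : s'.real 8 0 = s.real 9 0
  count : 0 ≤ s'.int 1 0
  record : IsRecord v p (s'.real 8 0) (s'.int 8 0) (outputList s')

lemma nextP_spec {n : ℕ} {v : ZMod n → Plane} {p : Plane} {s : State} (hn : s.int 0 0 = n)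
    (h1 : s.real 4 n = perimeter v) (h2 : s.real 4 (n + n) = 2 * perimeter v)
    (hc : 0 ≤ s.int 1 0) (hr : IsRecord v p (s.real 8 0) (s.int 8 0) (outputList s))
    (hs : IsSpan v p (s.real 8 0) (s.real 9 0) (s.int 6 (s.int 7 0))) :
    IsNext v p s (nextP.run s) := by
  classical
  by_cases hlt : s.real 8 0 < s.real 9 0
  · have hnext := hr.next hs hlt
    by_cases hcond : s.int 8 0 ≠ s.int 6 (s.int 7 0) ∧ perimeter v < s.real 8 0 ∧
        s.real 8 0 ≤ 2 * perimeter v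
    · rw [if_pos hcond] at hnext
      have hrun : nextP.run s = ((((s.writeR 3 (s.int 1 0) (s.real 8 0)).writeI 2 (s.int 1 0)
          (s.int 8 0)).writeI 1 0 (s.int 1 0 + 1)).writeR 8 0 (s.real 9 0)).writeI 8 0
          (s.int 6 (s.int 7 0)) := by
        have hb : ¬ (s.int 8 0 ≤ s.int 6 (s.int 7 0) ∧ s.int 6 (s.int 7 0) ≤ s.int 8 0) :=
          fun h => hcond.1 (le_antisymm h.1 h.2)
        simp [nextP, Program.run, BExp.eval, RExp.eval, IExp.eval, hlt, hn, h1, h2, hb, hcond.2,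
          real_writeR, int_writeI, int_writeR, real_writeI]
      rw [hrun]
      refine ⟨fun a ha => ?_, fun a ha => ?_, ?_, ?_, ?_⟩
      · simp at ha
        simp [int_writeI, int_writeR, ha]
      · simp at ha
        simp [real_writeR, real_writeI, ha]
      · simp [real_writeR, real_writeI]
      · simp [int_writeI, int_writeR]
        omega
      · rw [outputList_append (s := s) (x := s.real 8 0) (j := s.int 8 0) hc]
        · simpa [real_writeR, real_writeI, int_writeI, int_writeR] using hnext
        · simp [int_writeI, int_writeR]
        · simp [real_writeR, real_writeI]
        · simp [int_writeI, int_writeR]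
    · rw [if_neg hcond] at hnext
      have hrun : nextP.run s = (s.writeR 8 0 (s.real 9 0)).writeI 8 0 (s.int 6 (s.int 7 0)) := by
        have hb : ¬ (¬ (s.int 8 0 ≤ s.int 6 (s.int 7 0) ∧ s.int 6 (s.int 7 0) ≤ s.int 8 0) ∧
            ¬ s.real 8 0 ≤ perimeter v ∧ s.real 8 0 ≤ 2 * perimeter v) := by
          rintro ⟨h3, h4, h5⟩
          exact hcond ⟨fun h => h3 ⟨h.le, h.ge⟩, not_le.1 h4, h5⟩
        simp only [nextP, Program.run, BExp.eval, RExp.eval, IExp.eval, hn, h1, h2, if_neg hb,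
          if_pos (not_le.2 hlt), int_writeR]
      rw [hrun]
      refine ⟨fun a ha => ?_, fun a ha => ?_, ?_, ?_, ?_⟩
      · simp at ha
        simp [int_writeI, int_writeR, ha]
      · simp at ha
        simp [real_writeR, real_writeI, ha]
      · simp [real_writeR, real_writeI]
      · simpa [int_writeI, int_writeR] using hc
      · rw [outputList_congr (s := s)]
        · simpa [real_writeR, real_writeI, int_writeI, int_writeR] using hnext
        · simp [int_writeI, int_writeR]
        · simp [int_writeI, int_writeR]
        · simp [real_writeR, real_writeI]
  -- If the position does not move, the recorded destination must be kept: it still is the one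
  -- immediately to the left.
  · have hrun : nextP.run s = s := by
      simp [nextP, Program.run, BExp.eval, RExp.eval, IExp.eval, hlt]
    rw [hrun]
    have heq := le_antisymm hs.le (not_lt.1 hlt)
    exact ⟨fun _ _ => rfl, fun _ _ => rfl, heq, hc, hr⟩

end blocks

end RealRAM

namespace RealRAM

open FeedLink

/-! ### The main loop -/

section main

/-- The slope at the top of the stack. -/
abbrev topSlopeX : RExp := .get 6 (ivar 7)

/-- The value at the top of the stack. -/
abbrev topValueX : RExp := .get 7 (ivar 7)

/-- Removes the top of the stack. -/
def popP : Program :=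
  .seq (hitP (ivar 4) topSlopeX topValueX)
    (.seq nextP (.setI 7 (.const 0) (.sub (ivar 7) (.const 1))))

/-- Adds the current segment to the stack and goes to the next segment. -/
def stackP : Program :=
  .seq (conjP (ivar 4) (rvar 14) 10) (.seq (.setI 7 (.const 0) (succX (ivar 7)))
    (.seq (.setI 6 (ivar 7) (ivar 4)) (.seq (.setR 6 (ivar 7) (rvar 14))
      (.seq (.setR 7 (ivar 7) (rvar 10)) (.setI 4 (.const 0) (succX (ivar 4)))))))

/-- Finishes the current segment. -/
def pushP : Program :=
  .seq (.seq (tangentP (.get 6 (ivar 7)) (ivar 4)) (argP (ivar 4) (rvar 14) 9))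
    (.seq nextP (.seq (.seq stackP (.setR 9 (.const 0) (breakX (ivar 4)))) nextP))

/-- The body of the main loop. -/
def bodyP : Program :=
  .seq (conjP (ivar 4) topSlopeX 10) (.ite (.leR topValueX (rvar 10)) popP pushP)

variable {n : ℕ} {v : ZMod n → Plane} {p : Plane} {s s' : State}

local notation "ε" => breakpoint v
local notation "α" => fun i => distFun v p (breakpoint v i)

/-- The memory holds the breakpoints and the values of the plot there over three periods. -/
structure IsData (v : ZMod n → Plane) (p : Plane) (s : State) : Prop where
  size : s.int 0 0 = n
  bound : s.int 3 0 = 3 * n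
  breaks : ∀ k, 0 ≤ k → k ≤ 3 * (n : ℤ) → s.real 4 k = breakpoint v k
  values : ∀ k, 0 ≤ k → k ≤ 3 * (n : ℤ) → s.real 5 k = distFun v p (breakpoint v k)

/-- The invariant of the main loop. -/
structure MainInv (v : ZMod n → Plane) (p : Plane) (s : State) : Prop extends IsData v p s where
  seg_pos : 1 ≤ s.int 4 0
  seg_le : s.int 4 0 ≤ 3 * n
  count : 0 ≤ s.int 1 0
  stack : IsStack (breakpoint v) (fun i => distFun v p (breakpoint v i)) (s.int 4 0) (s.int 7 0)
    (s.int 6) (s.real 6) (s.real 7)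
  front : ∃ m, s.real 6 (s.int 7 0) < m ∧
    IsFront (breakpoint v) (fun i => distFun v p (breakpoint v i)) (distFun v p) (s.int 4 0)
      (s.int 6 (s.int 7 0)) (s.real 8 0) m
  record : IsRecord v p (s.real 8 0) (s.int 8 0) (outputList s)

lemma IsData.sameData (h : IsData v p s) {k : ℤ} (h0 : 0 ≤ k) (h1 : k + 1 ≤ 3 * (n : ℤ)) :
    SameData (s.real 4) (s.real 5) ε α k :=
  ⟨h.breaks k h0 (by omega), h.breaks (k + 1) (by omega) h1, h.values k h0 (by omega),
    h.values (k + 1) (by omega) h1⟩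

lemma IsData.next (h : IsData v p s) (hX : IsNext v p s s') : IsData v p s' := by
  refine ⟨?_, ?_, ?_, ?_⟩
  · rw [hX.int 0 (by simp), h.size]
  · rw [hX.int 3 (by simp), h.bound]
  · rw [hX.real 4 (by simp)]
    exact h.breaks
  · rw [hX.real 5 (by simp)]
    exact h.values

lemma IsData.nextP_spec (h : IsData v p s) (hn : 0 < n) (hc : 0 ≤ s.int 1 0)
    (hr : IsRecord v p (s.real 8 0) (s.int 8 0) (outputList s))
    (hs : IsSpan v p (s.real 8 0) (s.real 9 0) (s.int 6 (s.int 7 0))) :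
    IsNext v p s (nextP.run s) := by
  refine RealRAM.nextP_spec h.size ?_ ?_ hc hr hs
  · rw [h.breaks n (by omega) (by omega)]
    simpa using breakpoint_mul hn v 1
  · rw [h.breaks (n + n) (by omega) (by omega), ← two_mul]
    exact_mod_cast breakpoint_mul hn v 2

lemma IsData.congr (h : IsData v p s) (h1 : s'.int = s.int)
    (h2 : ∀ a < 9, s'.real a = s.real a) : IsData v p s' := by
  obtain ⟨a1, a2, a3, a4⟩ := h
  constructor
  · rwa [h1]
  · rwa [h1]
  · rwa [h2 4 (by norm_num)]
  · rwa [h2 5 (by norm_num)]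

lemma MainInv.congr (h : MainInv v p s) (h1 : s'.int = s.int)
    (h2 : ∀ a < 9, s'.real a = s.real a) : MainInv v p s' := by
  obtain ⟨a0, a1, a2, a3, a4, a5, a6⟩ := h
  refine ⟨a0.congr h1 h2, ?_, ?_, ?_, ?_, ?_, ?_⟩
  · rwa [h1]
  · rwa [h1]
  · rwa [h1]
  · rwa [h1, h2 6 (by norm_num), h2 7 (by norm_num)]
  · rwa [h1, h2 6 (by norm_num), h2 8 (by norm_num)]
  · rwa [h1, h2 8 (by norm_num), outputList_congr (s := s) (by rw [h1]) (by rw [h1])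
      (h2 3 (by norm_num))]

variable (hn : 0 < n) (hv : ∀ i : ZMod n, v i ≠ v (i + 1))

include hn hv

lemma popP_spec (h : MainInv v p s) (hi : s.int 4 0 + 1 ≤ 3 * n)
    (h1 : s.real 7 (s.int 7 0) ≤ FeedLink.conj ε α (s.int 4 0) (s.real 6 (s.int 7 0))) :
    MainInv v p (popP.run s) ∧ (popP.run s).int 4 0 = s.int 4 0 ∧
      (popP.run s).int 7 0 = s.int 7 0 - 1 ∧ 0 < s.int 7 0 := by
  have H := isPlot hn hv p
  obtain ⟨m, hm, F⟩ := h.front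
  have S := h.stack
  have hpos := h.seg_pos
  have hr := S.pos_of_le H h1
  have hD := h.sameData (show 0 ≤ s.int 4 0 by omega) hi
  set x := hitPos ε α (s.int 4 0) (s.real 6 (s.int 7 0)) (s.real 7 (s.int 7 0)) with hx
  set s₁ := s.writeR 9 0 x with hs₁
  have hrun : (hitP (ivar 4) topSlopeX topValueX).run s = s₁ := by
    rw [run_hitP]
    simp only [RExp.eval, IExp.eval, hD.hitPos, hs₁, hx]
  have hI : MainInv v p s₁ := h.congr rfl fun a ha => by
    rw [hs₁, real_writeR, if_neg ha.ne]
  have hspan := isSpan_pop hn hv S F hm h1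
  have hX : IsNext v p s₁ (nextP.run s₁) := by
    refine hI.nextP_spec hn hI.count hI.record ?_
    simp only [hs₁, real_writeR, int_writeR, if_true, Function.update_self]
    simpa using hspan
  have hfin : popP.run s = (nextP.run s₁).writeI 7 0 (s.int 7 0 - 1) := by
    simp only [popP, Program.run, hrun, IExp.eval, hX.int 7 (by simp)]
    rfl
  rw [hfin]
  set s₂ := nextP.run s₁ with hs₂
  have hD₂ := hI.toIsData.next hX
  have i4 : s₂.int 4 = s.int 4 := hX.int 4 (by simp)
  have i6 : s₂.int 6 = s.int 6 := hX.int 6 (by simp)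
  have i7 : s₂.int 7 = s.int 7 := hX.int 7 (by simp)
  have r6 : s₂.real 6 = s.real 6 := by
    rw [hX.real 6 (by simp), hs₁, real_writeR, if_neg (by norm_num)]
  have r7 : s₂.real 7 = s.real 7 := by
    rw [hX.real 7 (by simp), hs₁, real_writeR, if_neg (by norm_num)]
  have r8 : s₂.real 8 0 = x := by
    rw [hX.position, hs₁, real_writeR, if_pos rfl, Function.update_self]
  refine ⟨⟨⟨?_, ?_, hD₂.breaks, hD₂.values⟩, ?_, ?_, ?_, ?_, ?_, ?_⟩, ?_, ?_, hr⟩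
  · simpa [int_writeI] using hD₂.size
  · simpa [int_writeI] using hD₂.bound
  · simpa [int_writeI, i4] using h.seg_pos
  · simpa [int_writeI, i4] using h.seg_le
  · simpa [int_writeI] using hX.count
  · simpa [int_writeI, real_writeI, i4, i6, r6, r7] using S.pop hr
  · refine ⟨s.real 6 (s.int 7 0), ?_, ?_⟩
    · have := S.slope_mono (s.int 7 0 - 1) (by omega) (by omega)
      rw [sub_add_cancel] at this
      simpa [int_writeI, real_writeI, r6] using this
    · have := S.front_pop H F hm h1
      simpa [int_writeI, real_writeI, i4, i6, r8] using this
  · rw [outputList_congr (s := s₂) (s' := s₂.writeI 7 0 (s.int 7 0 - 1)) (by simp [int_writeI])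
      (by simp [int_writeI]) rfl]
    simpa [int_writeI, real_writeI] using hX.record
  · simp [int_writeI, i4]
  · simp [int_writeI]

/-- Two stretches are recorded: up to the point of tangency the destination is the old top, from
there on it is segment `i`. The stack is updated in between, so that the second `nextP` reads `i` as
the top. -/
lemma pushP_spec (h : MainInv v p s) (hi : s.int 4 0 + 1 ≤ 3 * n)
    (h1 : FeedLink.conj ε α (s.int 4 0) (s.real 6 (s.int 7 0)) < s.real 7 (s.int 7 0)) :
    MainInv v p (pushP.run s) ∧ (pushP.run s).int 4 0 = s.int 4 0 + 1 ∧
      (pushP.run s).int 7 0 = s.int 7 0 + 1 := by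
  have H := isPlot hn hv p
  obtain ⟨m, hm, F⟩ := h.front
  have S := h.stack
  have hpos := h.seg_pos
  have hr := S.nonneg
  have hki := S.idx_lt _ hr le_rfl
  have hk0 := S.top_nonneg
  have hD := h.sameData (show 0 ≤ s.int 4 0 by omega) hi
  have hDk := h.sameData hk0 (by omega)
  have hspan1 := isSpan_push hn hv S F h1
  have hspan2 := isSpan_self hn hv S F h1
  have hpush := S.push H F h1
  obtain ⟨-, hle1, -, -⟩ := H.tangentSlope_spec hki (by
    rwa [← S.value _ hr le_rfl])
  set i := s.int 4 0 with hi_def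
  set r := s.int 7 0 with hr_def
  set m' := tangentSlope ε α (s.int 6 r) i with hm'
  set x := argm ε α i m' with hx
  obtain ⟨hT1, hT2⟩ := tangentP_spec s (ivar 4) (.get 6 (ivar 7))
  have hTs : ((tangentP (.get 6 (ivar 7)) (ivar 4)).run s).real 14 0 = m' := by
    rw [hT2]
    exact hDk.tangentSlope hD
  set s₀ := (tangentP (.get 6 (ivar 7)) (ivar 4)).run s with hs₀
  have hI₀ : MainInv v p s₀ := h.congr hT1.int fun a ha => hT1.real a (by simp; omega)
  have i4₀ : s₀.int 4 0 = i := by rw [hT1.int]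
  have hD₀ := hI₀.sameData (show 0 ≤ i by omega) hi
  set s₁ := s₀.writeR 9 0 x with hs₁
  have hrun : (argP (ivar 4) (rvar 14) 9).run s₀ = s₁ := by
    rw [run_argP]
    simp only [RExp.eval, IExp.eval, hTs, i4₀, hD₀.argm, hs₁, hx]
  have hI : MainInv v p s₁ := hI₀.congr rfl fun a ha => by
    rw [hs₁, real_writeR, if_neg ha.ne]
  have hX : IsNext v p s₁ (nextP.run s₁) := by
    refine hI.nextP_spec hn hI.count hI.record ?_
    rw [hs₁, int_writeR, hT1.int, real_writeR, real_writeR, if_neg (by norm_num), if_pos rfl,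
      Function.update_self, hT1.real 8 (by simp)]
    exact hspan1
  set s₂ := nextP.run s₁ with hs₂
  have hD₂ := hI.toIsData.next hX
  have i4 : s₂.int 4 = s.int 4 := by rw [hX.int 4 (by simp), hs₁, int_writeR, hT1.int]
  have i6 : s₂.int 6 = s.int 6 := by rw [hX.int 6 (by simp), hs₁, int_writeR, hT1.int]
  have i7 : s₂.int 7 = s.int 7 := by rw [hX.int 7 (by simp), hs₁, int_writeR, hT1.int]
  have r6 : s₂.real 6 = s.real 6 := by
    rw [hX.real 6 (by simp), hs₁, real_writeR, if_neg (by norm_num), hT1.real 6 (by simp)]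
  have r7 : s₂.real 7 = s.real 7 := by
    rw [hX.real 7 (by simp), hs₁, real_writeR, if_neg (by norm_num), hT1.real 7 (by simp)]
  have r8 : s₂.real 8 0 = x := by
    rw [hX.position, hs₁, real_writeR, if_pos rfl, Function.update_self]
  have r14 : s₂.real 14 0 = m' := by
    rw [hX.real 14 (by simp), hs₁, real_writeR, if_neg (by norm_num), hTs]
  have hDi := hD₂.sameData (show 0 ≤ i by omega) hi
  have hbr : s₂.real 4 (i + 1) = ε (i + 1) := hDi.2.1
  set s₃ := ((((((s₂.writeR 10 0 (FeedLink.conj ε α i m')).writeI 7 0 (r + 1)).writeI 6 (r + 1)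
    i).writeR 6 (r + 1) m').writeR 7 (r + 1) (FeedLink.conj ε α i m')).writeI 4 0
    (i + 1)).writeR 9 0 (ε (i + 1)) with hs₃
  have hrun₃ : (Program.seq stackP (.setR 9 (.const 0) (breakX (ivar 4)))).run s₂ = s₃ := by
    simp only [stackP, Program.run]
    rw [run_conjP _ _ _ (by norm_num) (by norm_num) (by simp [RExp.eval, real_writeR, IExp.eval])]
    simp only [RExp.eval, IExp.eval, r14, i4, ← hi_def, hDi.conj]
    simp [int_writeI, int_writeR, real_writeR, real_writeI, i4, i7, ← hi_def, ← hr_def, r14, hbr,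
      hs₃]
  have o₃ : outputList s₃ = outputList s₂ :=
    outputList_congr (by simp [hs₃, int_writeI, int_writeR]) (by simp [hs₃, int_writeI, int_writeR])
      (by simp [hs₃, real_writeI, real_writeR])
  have hD₃ : IsData v p s₃ := by
    refine ⟨?_, ?_, ?_, ?_⟩
    · simpa [hs₃, int_writeI, int_writeR] using hD₂.size
    · simpa [hs₃, int_writeI, int_writeR] using hD₂.bound
    · simpa [hs₃, real_writeI, real_writeR] using hD₂.breaks
    · simpa [hs₃, real_writeI, real_writeR] using hD₂.values
  have j1 : s₃.int 1 = s₂.int 1 := by simp [hs₃, int_writeI, int_writeR]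
  have j4 : s₃.int 4 0 = i + 1 := by simp [hs₃, int_writeI, int_writeR]
  have j6 : s₃.int 6 = Function.update (s.int 6) (r + 1) i := by
    simp [hs₃, int_writeI, int_writeR, i6]
  have j7 : s₃.int 7 0 = r + 1 := by simp [hs₃, int_writeI, int_writeR]
  have j8 : s₃.int 8 = s₂.int 8 := by simp [hs₃, int_writeI, int_writeR]
  have q6 : s₃.real 6 = Function.update (s.real 6) (r + 1) m' := by
    simp [hs₃, real_writeI, real_writeR, r6]
  have q7 : s₃.real 7 = Function.update (s.real 7) (r + 1) (FeedLink.conj ε α i m') := by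
    simp [hs₃, real_writeI, real_writeR, r7]
  have q8 : s₃.real 8 = s₂.real 8 := by simp [hs₃, real_writeI, real_writeR]
  have q9 : s₃.real 9 0 = ε (i + 1) := by simp [hs₃, real_writeR]
  have hX₃ : IsNext v p s₃ (nextP.run s₃) := by
    refine hD₃.nextP_spec hn ?_ ?_ ?_
    · rw [j1]
      exact hX.count
    · rw [q8, j8, o₃]
      exact hX.record
    · rw [q8, r8, q9, j6, j7, Function.update_self]
      exact hspan2
  have hfin : pushP.run s = nextP.run s₃ := by
    rw [← hrun₃, hs₂, ← hrun, hs₀]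
    rfl
  rw [hfin]
  have k4 : (nextP.run s₃).int 4 0 = i + 1 := by rw [hX₃.int 4 (by simp), j4]
  have k6 : (nextP.run s₃).int 6 = Function.update (s.int 6) (r + 1) i := by
    rw [hX₃.int 6 (by simp), j6]
  have k7 : (nextP.run s₃).int 7 0 = r + 1 := by rw [hX₃.int 7 (by simp), j7]
  have t6 : (nextP.run s₃).real 6 = Function.update (s.real 6) (r + 1) m' := by
    rw [hX₃.real 6 (by simp), q6]
  have t7 : (nextP.run s₃).real 7 = Function.update (s.real 7) (r + 1) (FeedLink.conj ε α i m') := by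
    rw [hX₃.real 7 (by simp), q7]
  have t8 : (nextP.run s₃).real 8 0 = ε (i + 1) := by rw [hX₃.position, q9]
  refine ⟨⟨hD₃.next hX₃, ?_, ?_, hX₃.count, ?_, ?_, hX₃.record⟩, k4, k7⟩
  · rw [k4]
    omega
  · rw [k4]
    exact hi
  · rw [k4, k6, k7, t6, t7]
    exact hpush
  -- The new top has a slope at most `1`, so the front can restart at slope `2`.
  · refine ⟨2, ?_, ?_⟩
    · rw [k7, t6, Function.update_self]
      linarith
    · rw [k4, k6, k7, t8, Function.update_self]
      exact H.front_init i

/-- Amortization: a pop shortens the stack by one, and a push lengthens it by one but uses up a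
segment, which has weight `2`. Either way the potential drops by one. -/
lemma bodyP_spec (h : MainInv v p s) (hi : s.int 4 0 + 1 ≤ 3 * n) :
    MainInv v p (bodyP.run s) ∧
      (2 * (3 * n - (bodyP.run s).int 4 0) + (bodyP.run s).int 7 0).toNat <
        (2 * (3 * n - s.int 4 0) + s.int 7 0).toNat := by
  have hr := h.stack.nonneg
  have hpos := h.seg_pos
  have hD := h.sameData (show 0 ≤ s.int 4 0 by omega) hi
  set s₁ := s.writeR 10 0 (FeedLink.conj ε α (s.int 4 0) (s.real 6 (s.int 7 0))) with hs₁
  have hrun : (conjP (ivar 4) topSlopeX 10).run s = s₁ := by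
    rw [run_conjP _ _ _ (by norm_num) (by norm_num) (by simp [RExp.eval, real_writeR, IExp.eval,
      int_writeR])]
    simp only [RExp.eval, IExp.eval, hD.conj, hs₁]
  have hI : MainInv v p s₁ := h.congr rfl fun a ha => by
    rw [hs₁, real_writeR, if_neg (by omega)]
  have r6 : s₁.real 6 = s.real 6 := by simp [hs₁, real_writeR]
  have r7 : s₁.real 7 = s.real 7 := by simp [hs₁, real_writeR]
  have r10 : s₁.real 10 0 = FeedLink.conj ε α (s.int 4 0) (s.real 6 (s.int 7 0)) := by
    simp [hs₁, real_writeR]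
  simp only [bodyP, Program.run, hrun, BExp.eval, RExp.eval, IExp.eval, r7, r10]
  rw [show s₁.int 7 0 = s.int 7 0 from rfl]
  split_ifs with hc
  · obtain ⟨h1, h2, h3, h4⟩ := popP_spec hn hv hI hi (by rw [r6, r7]; exact hc)
    refine ⟨h1, ?_⟩
    rw [h2, h3, show s₁.int = s.int from rfl]
    omega
  · obtain ⟨h1, h2, h3⟩ := pushP_spec hn hv hI hi (by rw [r6, r7]; exact not_le.1 hc)
    refine ⟨h1, ?_⟩
    rw [h2, h3, show s₁.int = s.int from rfl]
    omega

end main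

end RealRAM

namespace RealRAM

open FeedLink

/-! ### The initial part of the program -/

section init

/-- The distance of two points, given by their coordinates. -/
def distX (x y x' y' : RExp) : RExp := .sqrt (.add (sqX (.sub x x')) (sqX (.sub y y')))

/-- Computes a breakpoint and a value of the plot. -/
def fillP : Program :=
  .seq (.setR 5 (ivar 4) (distX (rvar 2) (.get 2 (.const 1)) (.get 0 (ivar 5)) (.get 1 (ivar 5))))
    (.seq (.ite (.leI (ivar 0) (succX (ivar 5))) (.setI 5 (.const 1) (.const 0))
        (.setI 5 (.const 1) (succX (ivar 5))))
      (.seq (.setR 4 (succX (ivar 4)) (.add (breakX (ivar 4)) (distX (.get 0 (ivar 5))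
          (.get 1 (ivar 5)) (.get 0 (.get 5 (.const 1))) (.get 1 (.get 5 (.const 1))))))
        (.seq (.setI 4 (.const 0) (succX (ivar 4))) (.setI 5 (.const 0) (.get 5 (.const 1))))))

/-- Puts the first segment on the stack. -/
def startP : Program :=
  .seq (.setI 1 (.const 0) (.const 0)) (.seq (.setI 6 (.const 0) (.const 0))
    (.seq (.setI 7 (.const 0) (.const 0)) (.seq (.setR 6 (.const 0) (.const (-2)))
      (.seq (.setR 7 (.const 0) (.sub (.mul (.const (-2)) (breakX (.const 0))) (valueX (.const 0))))
        (.seq (.setI 4 (.const 0) (.const 1)) (.setR 8 (.const 0) (breakX (.const 1))))))))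

/-- Computes the size of the arrays. -/
def sizeP : Program := .setI 3 (.const 0) (.add (.add (ivar 0) (ivar 0)) (ivar 0))

/-- There are breakpoints left to compute. -/
def fillB : BExp := .leI (ivar 4) (ivar 3)

/-- There are segments left to process. -/
def bodyB : BExp := .leI (succX (ivar 4)) (ivar 3)

/-- The program that computes the retargeting positions. -/
def retargetP : Program :=
  .seq sizeP (.seq (.loop fillB fillP) (.seq startP (.loop bodyB bodyP)))

variable {n : ℕ} {v : ZMod n → Plane} {p : Plane} {s : State}

/-- The invariant of the loop that computes the breakpoints. -/
structure FillInv (v : ZMod n → Plane) (p : Plane) (s : State) : Prop where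
  size : s.int 0 0 = n
  bound : s.int 3 0 = 3 * n
  idx_nonneg : 0 ≤ s.int 4 0
  idx_le : s.int 4 0 ≤ 3 * n + 1
  res_nonneg : 0 ≤ s.int 5 0
  res_lt : s.int 5 0 < n
  res : (n : ℤ) ∣ s.int 4 0 - s.int 5 0
  vertex_fst : ∀ j, 0 ≤ j → j < (n : ℤ) → s.real 0 j = v (j : ZMod n) 0
  vertex_snd : ∀ j, 0 ≤ j → j < (n : ℤ) → s.real 1 j = v (j : ZMod n) 1
  point_fst : s.real 2 0 = p 0
  point_snd : s.real 2 1 = p 1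
  breaks : ∀ k, 0 ≤ k → k ≤ s.int 4 0 → s.real 4 k = breakpoint v k
  values : ∀ k, 0 ≤ k → k < s.int 4 0 → s.real 5 k = distFun v p (breakpoint v k)

lemma dist_plane (x y : Plane) :
    dist x y = √((x 0 - y 0) * (x 0 - y 0) + (x 1 - y 1) * (x 1 - y 1)) := by
  rw [EuclideanSpace.dist_eq, Fin.sum_univ_two, Real.dist_eq, Real.dist_eq, sq_abs, sq_abs, pow_two,
    pow_two]

lemma fillInv_init (hn : 0 < n) : FillInv v p (sizeP.run (inputState v p)) := by
  simp only [sizeP, Program.run, IExp.eval]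
  have hs : (inputState v p).int 0 0 = n := by simp [inputState]
  have h0 : ∀ a i, a ≠ 0 → (inputState v p).int a i = 0 := fun a i ha => by simp [inputState, ha]
  have r4 : (inputState v p).real 4 0 = 0 := by simp [inputState]
  constructor <;> simp only [int_writeI, real_writeI, hs]
  · simp [hs]
  · simp
    ring
  · simp [h0]
  · simp [h0]
    positivity
  · simp [h0]
  · simpa [h0] using hn
  · simp [h0]
  · intro j h1 h2
    simp [inputState, h1, h2]
  · intro j h1 h2
    simp [inputState, h1, h2]
  · simp [inputState]
  · simp [inputState]
  · intro k h1 h2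
    simp only [h0 4 0 (by norm_num), Nat.reduceEqDiff, if_false] at h2
    rw [le_antisymm h2 h1, r4, breakpoint_zero]
  · intro k h1 h2
    simp only [h0 4 0 (by norm_num), Nat.reduceEqDiff, if_false] at h2
    omega

lemma fillP_spec (hn : 0 < n) (hv : ∀ i : ZMod n, v i ≠ v (i + 1)) (h : FillInv v p s)
    (hi : s.int 4 0 ≤ 3 * n) :
    FillInv v p (fillP.run s) ∧ (fillP.run s).int 4 0 = s.int 4 0 + 1 := by
  set i := s.int 4 0 with hi_def
  set j := s.int 5 0 with hj_def
  have hi0 : 0 ≤ i := h.idx_nonneg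
  have hj0 : 0 ≤ j := h.res_nonneg
  have hjn : j < n := h.res_lt
  have hij : ((i : ℤ) : ZMod n) = (j : ZMod n) :=
    ((ZMod.intCast_eq_intCast_iff_dvd_sub j i n).2 h.res).symm
  -- The machine has no integer division, so the residue of the index is carried along and wrapped
  -- around at `n`.
  obtain ⟨j', hj', hj'0, hj'n, hdvd⟩ : ∃ j' : ℤ, j' = (if (n : ℤ) ≤ j + 1 then 0 else j + 1) ∧
      0 ≤ j' ∧ j' < n ∧ (n : ℤ) ∣ i + 1 - j' := by
    obtain ⟨z, hz⟩ := h.res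
    refine ⟨_, rfl, ?_⟩
    split_ifs with hc
    · refine ⟨le_rfl, by omega, z + 1, ?_⟩
      rw [← hi_def, ← hj_def] at hz
      have : j + 1 = n := by omega
      linear_combination hz + this
    · refine ⟨by omega, by omega, z, ?_⟩
      rw [← hi_def, ← hj_def] at hz
      linear_combination hz
  have hij' : ((i + 1 : ℤ) : ZMod n) = (j' : ZMod n) :=
    ((ZMod.intCast_eq_intCast_iff_dvd_sub j' (i + 1) n).2 hdvd).symm
  have hA : √((s.real 2 0 - s.real 0 j) * (s.real 2 0 - s.real 0 j) +
      (s.real 2 1 - s.real 1 j) * (s.real 2 1 - s.real 1 j)) = distFun v p (breakpoint v i) := by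
    rw [distFun_breakpoint hn hv, dist_plane, h.point_fst, h.point_snd, h.vertex_fst j hj0 hjn,
      h.vertex_snd j hj0 hjn, hij]
  have hE : s.real 4 i + √((s.real 0 j - s.real 0 j') * (s.real 0 j - s.real 0 j') +
      (s.real 1 j - s.real 1 j') * (s.real 1 j - s.real 1 j')) = breakpoint v (i + 1) := by
    rw [breakpoint_add_one hn, sideLength, dist_plane, h.breaks i hi0 le_rfl,
      h.vertex_fst j hj0 hjn, h.vertex_snd j hj0 hjn, h.vertex_fst j' hj'0 hj'n,
      h.vertex_snd j' hj'0 hj'n, hij, hij']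
  have hrun : fillP.run s = ((((s.writeR 5 i (distFun v p (breakpoint v i))).writeI 5 1 j').writeR 4
      (i + 1) (breakpoint v (i + 1))).writeI 4 0 (i + 1)).writeI 5 0 j' := by
    have h1 : (Program.ite (.leI (ivar 0) (succX (ivar 5))) (.setI 5 (.const 1) (.const 0))
        (.setI 5 (.const 1) (succX (ivar 5)))).run (s.writeR 5 i (distFun v p (breakpoint v i))) =
        (s.writeR 5 i (distFun v p (breakpoint v i))).writeI 5 1 j' := by
      simp only [Program.run, BExp.eval, IExp.eval, int_writeR, h.size, ← hj_def, hj']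
      split_ifs <;> rfl
    rw [fillP, Program.run, Program.run, Program.run, Program.run]
    rw [show (s.writeR 5 ((ivar 4).eval s) ((distX (rvar 2) (.get 2 (.const 1)) (.get 0 (ivar 5))
      (.get 1 (ivar 5))).eval s)) = s.writeR 5 i (distFun v p (breakpoint v i)) by
        rw [← hA]; rfl, h1]
    rw [← hE]
    simp [Program.run, IExp.eval, RExp.eval, distX, int_writeI, int_writeR, real_writeI,
      real_writeR, ← hi_def, ← hj_def]
  rw [hrun]
  refine ⟨?_, by simp [int_writeI, int_writeR]⟩
  constructor <;> simp [int_writeI, int_writeR, real_writeI, real_writeR]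
  · exact h.size
  · exact h.bound
  · omega
  · exact hi
  · exact hj'0
  · exact hj'n
  · exact hdvd
  · exact h.vertex_fst
  · exact h.vertex_snd
  · exact h.point_fst
  · exact h.point_snd
  · intro k h1 h2
    rcases h2.eq_or_lt with rfl | h2
    · rw [Function.update_self]
    · rw [Function.update_of_ne (by omega)]
      exact h.breaks k h1 (by omega)
  · intro k h1 h2
    rcases (show k ≤ i by omega).eq_or_lt with rfl | h2
    · rw [Function.update_self]
    · rw [Function.update_of_ne (by omega)]
      exact h.values k h1 (by omega)

lemma mainInv_start (hn : 0 < n) (hv : ∀ i : ZMod n, v i ≠ v (i + 1)) (h : FillInv v p s)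
    (hi : s.int 4 0 = 3 * n + 1) :
    MainInv v p (startP.run s) ∧ (startP.run s).int 4 0 = 1 ∧ (startP.run s).int 7 0 = 0 := by
  have H := isPlot hn hv p
  have hE : ∀ k, 0 ≤ k → k ≤ 3 * (n : ℤ) → s.real 4 k = breakpoint v k :=
    fun k h1 h2 => h.breaks k h1 (by omega)
  have hA : ∀ k, 0 ≤ k → k ≤ 3 * (n : ℤ) → s.real 5 k = distFun v p (breakpoint v k) :=
    fun k h1 h2 => h.values k h1 (by omega)
  have hrun : startP.run s = ((((((s.writeI 1 0 0).writeI 6 0 0).writeI 7 0 0).writeR 6 0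
      (-2)).writeR 7 0 (-2 * breakpoint v 0 - distFun v p (breakpoint v 0))).writeI 4 0 1).writeR 8 0
      (breakpoint v 1) := by
    simp [startP, Program.run, IExp.eval, RExp.eval, real_writeR, real_writeI,
      hE 0 le_rfl (by omega), hE 1 (by omega) (by omega), hA 0 le_rfl (by omega)]
  rw [hrun]
  set s' := ((((((s.writeI 1 0 0).writeI 6 0 0).writeI 7 0 0).writeR 6 0
      (-2)).writeR 7 0 (-2 * breakpoint v 0 - distFun v p (breakpoint v 0))).writeI 4 0 1).writeR 8 0
      (breakpoint v 1) with hs'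
  have i0 : s'.int 0 0 = n := by simpa [hs', int_writeI, int_writeR] using h.size
  have i1 : s'.int 1 0 = 0 := by simp [hs', int_writeI, int_writeR]
  have i3 : s'.int 3 0 = 3 * n := by simpa [hs', int_writeI, int_writeR] using h.bound
  have i4 : s'.int 4 0 = 1 := by simp [hs', int_writeI, int_writeR]
  have i6 : s'.int 6 0 = 0 := by simp [hs', int_writeI, int_writeR]
  have i7 : s'.int 7 0 = 0 := by simp [hs', int_writeI, int_writeR]
  have r4 : s'.real 4 = s.real 4 := by simp [hs', real_writeI, real_writeR]
  have r5 : s'.real 5 = s.real 5 := by simp [hs', real_writeI, real_writeR]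
  have r6 : s'.real 6 0 = -2 := by simp [hs', real_writeI, real_writeR]
  have r7 : s'.real 7 0 = -2 * breakpoint v 0 - distFun v p (breakpoint v 0) := by
    simp [hs', real_writeI, real_writeR]
  have r8 : s'.real 8 0 = breakpoint v 1 := by simp [hs', real_writeR]
  have hle : breakpoint v 1 ≤ perimeter v := by
    have h1 := (breakpoint_strictMono hn hv).monotone (show (1 : ℤ) ≤ 1 * n by omega)
    rw [breakpoint_mul hn] at h1
    simpa using h1
  refine ⟨⟨⟨i0, i3, by rwa [r4], by rwa [r5]⟩, i4.ge, by omega, i1.ge, ?_, ?_, ?_⟩, i4, i7⟩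
  · rw [i4, i7]
    refine IsStack.initial i6 r6 ?_
    rw [r7, H.conj_eq_left]
    linarith [(abs_le.1 (H.abs_slopeL_le (i := 0))).1]
  · refine ⟨2, ?_, ?_⟩
    · rw [i7, r6]
      norm_num
    · rw [i4, i7, i6, r8]
      exact H.front_init 0
  · have hout : outputList s' = [] := by simp [outputList_eq, i1]
    rw [hout, r8]
    -- The start `e 1` is at most `μ`, so nothing has to be known yet about positions beyond `μ`,
    -- and the initial destination is irrelevant.
    refine ⟨List.Pairwise.nil, by simp, by simp, by simp, by simp, fun x h1 _ h2 => ?_,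
      fun h1 => ?_, fun h1 => ?_⟩ <;> linarith

lemma loopFree_fillP : fillP.LoopFree := by
  simp [fillP, Program.LoopFree]

lemma loopFree_startP : startP.LoopFree := by
  simp [startP, Program.LoopFree]

lemma loopFree_bodyP : bodyP.LoopFree := by
  simp [bodyP, popP, pushP, stackP, hitP, tangentP, pieceP, tripleP, conjP, argP, nextP,
    Program.LoopFree]

/-- The program runs in linear time and lists the retargeting positions. -/
lemma retargetP_spec (hn : 0 < n) (hv : ∀ i : ZMod n, v i ≠ v (i + 1)) :
    ∃ s t, Exec retargetP (inputState v p) s t ∧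
      t ≤ (sizeP.maxCost + (5 * (fillB.cost + fillP.maxCost + 1) + (startP.maxCost +
        6 * (bodyB.cost + bodyP.maxCost + 1)))) * n ∧
      IsRetargetingList v p (outputList s) := by
  obtain ⟨t₀, ht₀, e₀⟩ := Program.LoopFree.exec (c := sizeP) trivial (inputState v p)
  have f₀ := fillInv_init (v := v) (p := p) hn
  set s₀ := sizeP.run (inputState v p)
  obtain ⟨s₁, t₁, e₁, f₁, b₁, ht₁⟩ := exec_loop (b := fillB) loopFree_fillP (FillInv v p)
    (fun s => (3 * n + 1 - s.int 4 0).toNat) (fun s hs hb => by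
      simp only [fillB, BExp.eval, IExp.eval, hs.bound] at hb
      obtain ⟨h1, h2⟩ := fillP_spec hn hv hs hb
      refine ⟨h1, ?_⟩
      rw [h2]
      omega) s₀ f₀
  obtain ⟨t₂, ht₂, e₂⟩ := loopFree_startP.exec s₁
  simp only [fillB, BExp.eval, IExp.eval, f₁.bound, not_le] at b₁
  obtain ⟨f₂, g₂, g₂'⟩ := mainInv_start hn hv f₁ (by have := f₁.idx_le; omega)
  set s₂ := startP.run s₁
  obtain ⟨s₃, t₃, e₃, f₃, b₃, ht₃⟩ := exec_loop (b := bodyB) loopFree_bodyP (MainInv v p)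
    (fun s => (2 * (3 * n - s.int 4 0) + s.int 7 0).toNat) (fun s hs hb => by
      simp only [bodyB, BExp.eval, IExp.eval, hs.bound] at hb
      exact bodyP_spec hn hv hs hb) s₂ f₂
  simp only [bodyB, BExp.eval, IExp.eval, f₃.bound, not_le] at b₃
  refine ⟨s₃, _, .seq e₀ (.seq e₁ (.seq e₂ e₃)), ?_, ?_⟩
  -- `3 n + 2 ≤ 5 n` because `n ≥ 1`; in the next bound the initial potential is `2 (3 n - 1)`.
  · have h1 : (3 * (n : ℤ) + 1 - s₀.int 4 0).toNat + 1 ≤ 5 * n := by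
      have := f₀.idx_nonneg
      omega
    have h2 : (2 * (3 * (n : ℤ) - s₂.int 4 0) + s₂.int 7 0).toNat + 1 ≤ 6 * n := by
      rw [g₂, g₂']
      omega
    have h3 := ht₁.trans (Nat.mul_le_mul_right _ h1)
    have h4 := ht₃.trans (Nat.mul_le_mul_right _ h2)
    have h5 := ht₀.trans (Nat.le_mul_of_pos_right _ hn)
    have h6 := ht₂.trans (Nat.le_mul_of_pos_right _ hn)
    calc t₀ + (t₁ + (t₂ + t₃)) ≤ sizeP.maxCost * n + (5 * n * (fillB.cost + fillP.maxCost + 1) +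
        (startP.maxCost * n + 6 * n * (bodyB.cost + bodyP.maxCost + 1))) := by gcongr
      _ = _ := by ring
  · refine f₃.record.isRetargetingList hn hv ?_
    -- At the end the current segment is `3 n`, so the last position is at least `3 μ`, beyond the
    -- window `(μ, 2 μ]`.
    obtain ⟨m, -, F⟩ := f₃.front
    have h1 := F.mem.1
    rw [show s₃.int 4 0 = 3 * (n : ℤ) by have := f₃.seg_le; omega, breakpoint_mul hn] at h1
    have := perimeter_pos hn hv
    push_cast at h1
    linarith

end init

end RealRAM

theorem mainTheorem3 :
    ∃ (prog : RealRAM.Program) (C : ℕ),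
      ∀ (n : ℕ) (v : ZMod n → FeedLink.Plane) (p : FeedLink.Plane),
        2 ≤ n → (∀ i : ZMod n, v i ≠ v (i + 1)) →
        ∃ (s : RealRAM.State) (t : ℕ),
          RealRAM.Exec prog (RealRAM.inputState v p) s t ∧
          t ≤ C * n ∧
          FeedLink.IsRetargetingList v p (RealRAM.outputList s) :=
  ⟨RealRAM.retargetP, _, fun _ _ _ hn hv => RealRAM.retargetP_spec (by omega) hv⟩
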